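/- **Setting.** Let $\Omega$ be a finite sample space with probability $\mathbb P$; each $\omega\in\Omega$ has components $\omega_t\in\Omega_t$, $t=0,\dots,T$ ($\Omega_t$ finite, $\omega_0$ deterministic), and $\omega_t$ determines the data $(A_t,B_t,b_t,c_t)$ and a post-decision information state $I_t^x=I_t^x(\omega_t)$. Put $\mathcal X_t(R,\omega_t)=\{x\ge 0:\ R+A_tx=b_t\}$. Consider the multistage linear problem of minimizing $\mathbb E\big[\sum_{t=0}^T\langle c_t,x_t\rangle\big]$ over all feasible implementable policies: $x_t$ depends only on $\omega_0,\dots,\omega_t$, and $x_t\in\mathcal X_t(R^x_{t-1},\omega_t)$ with $R^x_{-1}=0$ and $R^x_t=B_tx_t$. Assume relatively complete recourse: along every scenario, feasible decisions of stages $0,\dots,t$ leave stage $t+1$ feasible, for $t<T$. Assume that the process is Markov: $\mathbb P(\omega_{t+1}\mid \omega_0,\dots,\omega_t)=\mathbb P(\omega_{t+1}\mid I_t^x)$. The optimal post-decision value functions are $V^*_T=0$ and $V^*_t(R,j)=\sum_{w\in\Omega_{t+1}}\mathbb P(\omega_{t+1}=w\mid I_t^x=j)\,\min_{x\in\mathcal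 X_{t+1}(R,w)}\{\langle c_{t+1},x\rangle+V^*_{t+1}(B_{t+1}x,I_{t+1}^x(w))\}$ for $t<T$. **Algorithm (regularized Markov SDDP).** Given $Q_t\succeq0$ and coefficients $\varrho^k$, iteration $k=0,1,2,\dots$ samples a scenario $\omega^k$ with law $\mathbb P$, independently of everything computed before and of the rule used to break ties in iteration $k$. *Forward pass.* For each scenario $\omega$ that could be sampled, a decision $x^k_t(\omega)$, depending on $\omega$ only through $\omega_0,\dots,\omega_t$, is selected among the minimizers over $\mathcal X_t(R^{k}_{t-1}(\omega),\omega_t)$, where $R^k_{-1}=0$ and $R^k_t(\omega)=B_t(\omega_t)x^k_t(\omega)$, of - $\langle c_t,x\rangle$ if $k=0$; - $\langle c_t,x\rangle+\overline V_t^{k-1}(B_tx,I_t^x)+\frac{\varrho^k}{2}\langle B_tx-R_t^{x,k-1},Q_t(B_tx-R_t^{x,k-1})\rangle$ if $k\ge1$, $t<T$; - $\langle c_T,x\rangle+\overline V_T^{k-1}(B_Tx,I_T^x)$ if $k\ge1$, $t=T$. The decisions actually taken are those for $\omega=\omega^k$, and $R_t^{x,k}=R^k_t(\omega^k)$. *Backward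 pass.* For $t=T,\dots,1$, let $\underline V_t^k(R,w)=\min_{x\in\mathcal X_t(R,w)}\{\langle c_t,x\rangle+\overline V_t^k(B_tx,I_t^x(w))\}$ and select, for each $w\in\Omega_t$, a subgradient $\underline\beta_t^k(w)\in\partial_R\underline V_t^k(R_{t-1}^{x,k},w)$. For each information state $j$ of stage $t-1$, put $\alpha_{t-1}^k(j)=\sum_w\mathbb P(\omega_t=w\mid I_{t-1}^x=j)\,\underline V_t^k(R_{t-1}^{x,k},w)$ and $\beta_{t-1}^k(j)=\sum_w\mathbb P(\omega_t=w\mid I_{t-1}^x=j)\,\underline\beta_t^k(w)$, and set $\overline V_{t-1}^k(R,j)=\max\{\overline V_{t-1}^{k-1}(R,j),\ \alpha_{t-1}^k(j)+\langle\beta_{t-1}^k(j),R-R_{t-1}^{x,k}\rangle\}$, starting from $-\infty$. **Theorem** (convergence, Markov case)**.** Suppose that 1. $\overline V_T^k(\cdot,I_T^x)=V_T^*(\cdot,I_T^x)$ for every information state and every $k$; 2. the subgradients of the backward pass come from dual basic optimal solutions of the linear programs defining $\underline V_t^k(R_{t-1}^{x,k},w)$; 3. $\mathbb P(\omega)>0$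 for every $\omega\in\Omega$; 4. $\varrho^k\ge0$ and $\varrho^k\to0$; 5. all feasible sets $\mathcal X_t$ are bounded. Then, with probability one, the method converges to an optimal policy after finitely many iterations: there is a (random) $K$ such that for all $k\ge K$ the policy $x^k$ of the forward pass is an optimal policy of the multistage problem, and for every $\omega\in\Omega$ and $t=0,\dots,T$, at the state $(R^k_{t-1}(\omega),\omega_t)$ that it visits, $x^k_t(\omega)$ minimizes the unregularized objective $\langle c_t,x\rangle+\overline V^k_t(B_tx,I_t^x)$ over $\mathcal X_t(R^k_{t-1}(\omega),\omega_t)$ and $$\min_{x\in\mathcal X_t(R^k_{t-1}(\omega),\omega_t)}\{\langle c_t,x\rangle+\overline V_t^k(B_tx,I_t^x)\}=\min_{x\in\mathcal X_t(R^k_{t-1}(\omega),\omega_t)}\{\langle c_t,x\rangle+V_t^*(B_tx,I_t^x)\}.$$ -/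

import Mathlib

open Filter Topology MeasureTheory
open scoped Matrix

/-- Data of a `(T+1)`-stage linear stochastic program driven by a finite information process.
`Scen` is the finite sample space `Ω` with probabilities `prob`; `obs t ω` is the stage-`t`
component `ω_t ∈ Ω_t = Obs t` of the scenario `ω`; the stage-`t` data `(A_t, B_t, b_t, c_t)` are
functions of `ω_t`, and stage `0` is deterministic. `info t ω_t ∈ Info t` is the post-decision
information state `I_t^x`. Only the stages `t ≤ T` are ever used. -/
structure StochLP (T : ℕ) where
  Scen : Type
  fintypeScen : Fintype Scen
  prob : Scen → ℝ
  prob_nonneg : ∀ ω, 0 ≤ prob ω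
  prob_sum : ∑ ω, prob ω = 1
  Obs : ℕ → Type
  fintypeObs : ∀ t, Fintype (Obs t)
  obs : (t : ℕ) → Scen → Obs t
  obs_zero : ∀ ω ω' : Scen, obs 0 ω = obs 0 ω'
  Info : ℕ → Type
  info : (t : ℕ) → Obs t → Info t
  /-- `n t` is the number of decision variables, `m t` the number of constraints of stage `t`. -/
  n : ℕ → ℕ
  m : ℕ → ℕ
  A : (t : ℕ) → Obs t → Matrix (Fin (m t)) (Fin (n t)) ℝ
  B : (t : ℕ) → Obs t → Matrix (Fin (m (t + 1))) (Fin (n t)) ℝ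
  b : (t : ℕ) → Obs t → (Fin (m t) → ℝ)
  c : (t : ℕ) → Obs t → (Fin (n t) → ℝ)

noncomputable section

namespace StochLP

attribute [instance] StochLP.fintypeScen StochLP.fintypeObs

variable {T : ℕ} (M : StochLP T)

/-! ### The information process -/

/-- Probability of an event. -/
def P (s : Set M.Scen) : ℝ := ∑ ω, s.indicator M.prob ω

/-- Conditional probability `P(s | u)`. -/
def condP (s u : Set M.Scen) : ℝ := M.P (s ∩ u) / M.P u

/-- Transition probability `P(ω_{t+1} = w | I_t^x = j)`. -/
def trans (t : ℕ) (j : M.Info t) (w : M.Obs (t + 1)) : ℝ :=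
  M.condP {ω | M.obs (t + 1) ω = w} {ω | M.info t (M.obs t ω) = j}

/-- Markov property: `P(ω_{t+1} | H_t) = P(ω_{t+1} | I_t^x)`, where `H_t` is the history
`ω_0, …, ω_t`; since `I_t^x` is a function of `ω_t`, both also equal `P(ω_{t+1} | ω_t)`. -/
def IsMarkov : Prop :=
  ∀ t < T, ∀ (ω : M.Scen) (w : M.Obs (t + 1)),
    M.condP {ω' | M.obs (t + 1) ω' = w} {ω' | ∀ s ≤ t, M.obs s ω' = M.obs s ω} =
      M.trans t (M.info t (M.obs t ω)) w

/-! ### The multistage problem -/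

/-- Feasible set `{x ≥ 0 : R + A_t x = b_t}` of stage `t`, where `R = B_{t-1} x_{t-1}` is the
incoming post-decision resource state (`R = 0` for `t = 0`). -/
def X (t : ℕ) (R : Fin (M.m t) → ℝ) (w : M.Obs t) : Set (Fin (M.n t) → ℝ) :=
  {x | 0 ≤ x ∧ R + M.A t w *ᵥ x = M.b t w}

/-- Incoming resource state of stage `t` when the decisions `x` are taken along `ω`:
`0` for `t = 0`, and `B_{t-1} x_{t-1}` for `t > 0`. -/
def resIn (x : (t : ℕ) → (Fin (M.n t) → ℝ)) (ω : M.Scen) : (t : ℕ) → (Fin (M.m t) → ℝ)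
  | 0 => 0
  | t + 1 => M.B t (M.obs t ω) *ᵥ x t

/-- Relatively complete recourse: along every scenario, feasible decisions of the stages `0, …, t`
leave the stage `t + 1` problem feasible. -/
def RelativelyCompleteRecourse : Prop :=
  ∀ t < T, ∀ (ω : M.Scen) (x : (s : ℕ) → (Fin (M.n s) → ℝ)),
    (∀ s ≤ t, x s ∈ M.X s (M.resIn x ω s) (M.obs s ω)) →
      (M.X (t + 1) (M.resIn x ω (t + 1)) (M.obs (t + 1) ω)).Nonempty

/-- A decision rule that may use the scenario: `x t ω` is the stage-`t` decision along `ω`. -/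
abbrev Policy : Type := (t : ℕ) → M.Scen → (Fin (M.n t) → ℝ)

/-- Implementable policies: the decision of stage `t` depends on `ω_0, …, ω_t` only. -/
def Implementable (x : M.Policy) : Prop :=
  ∀ t ≤ T, ∀ ω ω' : M.Scen, (∀ s ≤ t, M.obs s ω = M.obs s ω') → x t ω = x t ω'

/-- Incoming resource state of stage `t` along `ω` under the policy `x`. -/
def state (x : M.Policy) (ω : M.Scen) (t : ℕ) : Fin (M.m t) → ℝ :=
  M.resIn (fun s => x s ω) ω t

/-- Feasible and implementable policies. -/
def IsFeasiblePolicy (x : M.Policy) : Prop :=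
  M.Implementable x ∧ ∀ ω, ∀ t ≤ T, x t ω ∈ M.X t (M.state x ω t) (M.obs t ω)

/-- Expected total cost of a policy. -/
def cost (x : M.Policy) : ℝ :=
  ∑ ω, M.prob ω * ∑ t ∈ Finset.range (T + 1), M.c t (M.obs t ω) ⬝ᵥ x t ω

/-- Optimal policies of the multistage problem. -/
def IsOptimalPolicy (x : M.Policy) : Prop :=
  M.IsFeasiblePolicy x ∧ ∀ y, M.IsFeasiblePolicy y → M.cost x ≤ M.cost y

/-- Stage-`t` objective `⟨c_t, x⟩ + V(B_t x, I_t^x)` for a post-decision value function `V`. -/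
def obj (t : ℕ) (V : M.Info t → (Fin (M.m (t + 1)) → ℝ) → ℝ) (w : M.Obs t)
    (x : Fin (M.n t) → ℝ) : ℝ :=
  M.c t w ⬝ᵥ x + V (M.info t w) (M.B t w *ᵥ x)

/-- `min_{x ∈ X_t(R, w)} ⟨c_t, x⟩ + V(B_t x, I_t^x)`. -/
def stageMin (t : ℕ) (V : M.Info t → (Fin (M.m (t + 1)) → ℝ) → ℝ)
    (R : Fin (M.m t) → ℝ) (w : M.Obs t) : ℝ :=
  sInf (M.obj t V w '' M.X t R w)

/-- Nested optimal cost of the `s` stages after stage `t`, given the post-decision state. -/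
def costToGo : (s t : ℕ) → M.Info t → (Fin (M.m (t + 1)) → ℝ) → ℝ
  | 0, _ => fun _ _ => 0
  | s + 1, t => fun j R =>
      ∑ w : M.Obs (t + 1), M.trans t j w * M.stageMin (t + 1) (costToGo s (t + 1)) R w

/-- The optimal post-decision value functions `V*_t`, so that `V*_T = 0` and
`V*_t(R, j) = 𝔼[min_x ⟨c_{t+1}, x⟩ + V*_{t+1}(B_{t+1} x, I_{t+1}^x) | I_t^x = j]` for `t < T`. -/
def Vstar (t : ℕ) : M.Info t → (Fin (M.m (t + 1)) → ℝ) → ℝ := M.costToGo (T - t) t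

/-! ### The algorithm -/

/-- Everything computed in one execution. In iteration `k`, `sample k` is the sampled scenario;
`x k t ω` is the decision that the forward pass takes at stage `t` if the sampled scenario is `ω`
(so the decision actually taken is `x k t (sample k)`); `subgrad k t w` is the selected subgradient
of the stage-`t` subproblem; `alpha k t j` and `beta k t j` are the height and slope of the new cut
for `V̄_t(·, j)`; and `Vbar k t j` is the approximate value function `V̄_t^k(·, j)`. -/
structure Trace where
  sample : ℕ → M.Scen
  x : ℕ → M.Policy
  subgrad : ℕ → (t : ℕ) → M.Obs t → (Fin (M.m t) → ℝ)
  alpha : ℕ → (t : ℕ) → M.Info t → ℝ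
  beta : ℕ → (t : ℕ) → M.Info t → (Fin (M.m (t + 1)) → ℝ)
  Vbar : ℕ → (t : ℕ) → M.Info t → (Fin (M.m (t + 1)) → ℝ) → ℝ

variable {M}

/-- The resource state `R_t^{x,k}` visited by the forward pass of iteration `k`. -/
def Trace.Rx (r : M.Trace) (k t : ℕ) : Fin (M.m (t + 1)) → ℝ :=
  M.B t (M.obs t (r.sample k)) *ᵥ r.x k t (r.sample k)

/-- The cut `h_t^k(R, j) = α_t^k(j) + ⟨β_t^k(j), R - R_t^{x,k}⟩`. -/
def Trace.cut (r : M.Trace) (k t : ℕ) (j : M.Info t) (R : Fin (M.m (t + 1)) → ℝ) : ℝ :=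
  r.alpha k t j + r.beta k t j ⬝ᵥ (R - r.Rx k t)

/-- Objective of the forward pass of iteration `k` at stage `t`: the cost `⟨c_t, x⟩` if `k = 0`, to
which `V̄_t^{k-1}` and, for `t < T`, the quadratic regularization around the resource state visited
in iteration `k - 1` are added if `k > 0`. -/
def Trace.forwardObj (r : M.Trace)
    (Q : (t : ℕ) → Matrix (Fin (M.m (t + 1))) (Fin (M.m (t + 1))) ℝ) (ρ : ℕ → ℝ) :
    (k t : ℕ) → M.Obs t → (Fin (M.n t) → ℝ) → ℝ
  | 0, t => fun w x => M.c t w ⬝ᵥ x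
  | k + 1, t => fun w x =>
      M.obj t (r.Vbar k t) w x +
        if t < T then
          ρ (k + 1) / 2 *
            ((M.B t w *ᵥ x - r.Rx k t) ⬝ᵥ (Q t *ᵥ (M.B t w *ᵥ x - r.Rx k t)))
        else 0

/-- `g` is a subgradient at `R` of the function equal to `f` on `D` and to `+∞` off `D`. -/
def IsSubgradient {d : ℕ} (D : Set (Fin d → ℝ)) (f : (Fin d → ℝ) → ℝ) (R g : Fin d → ℝ) : Prop :=
  R ∈ D ∧ ∀ R' ∈ D, f R + g ⬝ᵥ (R' - R) ≤ f R'

/-- `r` is an execution of the regularized Markov SDDP method with matrices `Q` and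
penalty coefficients `ρ`. -/
structure IsRun (Q : (t : ℕ) → Matrix (Fin (M.m (t + 1))) (Fin (M.m (t + 1))) ℝ) (ρ : ℕ → ℝ)
    (r : M.Trace) : Prop where
  /-- Forward decisions do not look ahead in the sampled scenario. -/
  implementable : ∀ k, M.Implementable (r.x k)
  forward_mem : ∀ k, ∀ t ≤ T, ∀ ω, r.x k t ω ∈ M.X t (M.state (r.x k) ω t) (M.obs t ω)
  forward_min : ∀ k, ∀ t ≤ T, ∀ ω,
    IsMinOn (r.forwardObj Q ρ k t (M.obs t ω)) (M.X t (M.state (r.x k) ω t) (M.obs t ω))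
      (r.x k t ω)
  /-- Backward pass: a subgradient of `V̲_{t+1}^k(·, w)` at `R_t^{x,k}`, for every `w ∈ Ω_{t+1}`. -/
  backward_subgrad : ∀ k, ∀ t < T, ∀ w : M.Obs (t + 1),
    IsSubgradient {R | (M.X (t + 1) R w).Nonempty}
      (fun R => M.stageMin (t + 1) (r.Vbar k (t + 1)) R w) (r.Rx k t) (r.subgrad k (t + 1) w)
  backward_alpha : ∀ k, ∀ t < T, ∀ j,
    r.alpha k t j =
      ∑ w, M.trans t j w * M.stageMin (t + 1) (r.Vbar k (t + 1)) (r.Rx k t) w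
  backward_beta : ∀ k, ∀ t < T, ∀ j,
    r.beta k t j = ∑ w, M.trans t j w • r.subgrad k (t + 1) w
  /-- The initial approximation is `-∞`, so after iteration `0` it is the first cut. -/
  Vbar_zero : ∀ t < T, ∀ j R, r.Vbar 0 t j R = r.cut 0 t j R
  Vbar_succ : ∀ k, ∀ t < T, ∀ j R,
    r.Vbar (k + 1) t j R = max (r.Vbar k t j R) (r.cut (k + 1) t j R)

/-! ### Dual basic optimal solutions

The subproblem `min {⟨c, x⟩ + max_i (a_i + ⟨g_i, B x⟩) : A x = q, x ≥ 0}` is the linear program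
`min ⟨c, x⟩ + θ` subject to `A x = q`, `θ - ⟨g_i, B x⟩ ≥ a_i` for all `i`, `x ≥ 0`, `θ` free. Its
dual is `max ⟨q, y⟩ + ∑ a_i z_i` subject to `Aᵀ y - ∑ z_i Bᵀ g_i ≤ c`, `∑ z_i = 1`, `z ≥ 0`,
`y` free. -/

section Dual

variable {p q d : ℕ} {ι : Type} [Fintype ι]

/-- The left-hand side `Aᵀ y - ∑ z_i Bᵀ g_i` of the dual constraints. -/
def dualLhs (A : Matrix (Fin p) (Fin q) ℝ) (B : Matrix (Fin d) (Fin q) ℝ)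
    (g : ι → Fin d → ℝ) (y : Fin p → ℝ) (z : ι → ℝ) : Fin q → ℝ :=
  Aᵀ *ᵥ y - Bᵀ *ᵥ ∑ i, z i • g i

def DualFeasible (A : Matrix (Fin p) (Fin q) ℝ) (B : Matrix (Fin d) (Fin q) ℝ)
    (c : Fin q → ℝ) (g : ι → Fin d → ℝ) (y : Fin p → ℝ) (z : ι → ℝ) : Prop :=
  dualLhs A B g y z ≤ c ∧ 0 ≤ z ∧ ∑ i, z i = 1

/-- `(y, z)` maximizes the dual objective over the dual feasible set. -/
def DualOptimal (A : Matrix (Fin p) (Fin q) ℝ) (B : Matrix (Fin d) (Fin q) ℝ)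
    (c : Fin q → ℝ) (g : ι → Fin d → ℝ) (a : ι → ℝ) (rhs : Fin p → ℝ)
    (y : Fin p → ℝ) (z : ι → ℝ) : Prop :=
  DualFeasible A B c g y z ∧
    ∀ y' z', DualFeasible A B c g y' z' → rhs ⬝ᵥ y' + a ⬝ᵥ z' ≤ rhs ⬝ᵥ y + a ⬝ᵥ z

/-- `(y, z)` is basic for the dual in standard form (slacks added, each free `y_i` split into its
positive and negative part): the columns of the nonzero variables are linearly independent, that
is, no nonzero direction supported on the nonzero variables satisfies the homogeneous equations.
Every extreme point of the dual feasible set is basic; if `A` has dependent rows, so that there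
is no extreme point, basic solutions still make sense. -/
def DualBasic (A : Matrix (Fin p) (Fin q) ℝ) (B : Matrix (Fin d) (Fin q) ℝ)
    (c : Fin q → ℝ) (g : ι → Fin d → ℝ) (y : Fin p → ℝ) (z : ι → ℝ) : Prop :=
  ∀ (y' : Fin p → ℝ) (z' : ι → ℝ),
    (∀ i, y i = 0 → y' i = 0) → (∀ i, z i = 0 → z' i = 0) → ∑ i, z' i = 0 →
    (∀ l, dualLhs A B g y z l = c l → dualLhs A B g y' z' l = 0) → y' = 0 ∧ z' = 0

end Dual

/-- The subgradients of the backward pass come from dual basic optimal solutions: if `y` is the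
optimal multiplier of `A_t x = b_t - R`, then `-y` is the subgradient with respect to `R`.
For `t < T` the subproblem contains the cuts of the iterations `0, …, k`, with
slopes `β_t^i` and constant terms `α_t^i - ⟨β_t^i, R_t^{x,i}⟩`; the terminal function
`V*_T = 0` is the maximum of the single cut `0`. -/
def UsesDualBasicSolutions (r : M.Trace) : Prop :=
  ∀ k, ∀ t < T, ∀ w : M.Obs (t + 1),
    (t + 1 < T →
      ∃ (y : Fin (M.m (t + 1)) → ℝ) (z : Fin (k + 1) → ℝ),
        DualOptimal (M.A (t + 1) w) (M.B (t + 1) w) (M.c (t + 1) w)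
          (fun i : Fin (k + 1) => r.beta i (t + 1) (M.info (t + 1) w))
          (fun i : Fin (k + 1) => r.alpha i (t + 1) (M.info (t + 1) w) -
            r.beta i (t + 1) (M.info (t + 1) w) ⬝ᵥ r.Rx i (t + 1))
          (M.b (t + 1) w - r.Rx k t) y z ∧
        DualBasic (M.A (t + 1) w) (M.B (t + 1) w) (M.c (t + 1) w)
          (fun i : Fin (k + 1) => r.beta i (t + 1) (M.info (t + 1) w)) y z ∧
        r.subgrad k (t + 1) w = -y) ∧
    (t + 1 = T →
      ∃ (y : Fin (M.m (t + 1)) → ℝ) (z : Unit → ℝ),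
        DualOptimal (M.A (t + 1) w) (M.B (t + 1) w) (M.c (t + 1) w)
          (fun _ : Unit => 0) (fun _ : Unit => 0) (M.b (t + 1) w - r.Rx k t) y z ∧
        DualBasic (M.A (t + 1) w) (M.B (t + 1) w) (M.c (t + 1) w)
          (fun _ : Unit => 0) y z ∧
        r.subgrad k (t + 1) w = -y)

/-- The sampling mechanism of a random execution. `𝒢 k` is the information available just before
the scenario of iteration `k` is sampled (including any randomness used to break ties). The forward
rule of iteration `k` is fixed by `𝒢 k`, the scenario is drawn independently of `𝒢 k` with the law
of the information process, and the backward pass of iteration `k` is known at the start of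
iteration `k + 1`. -/
structure IsSampling {Ξ : Type*} {mΞ : MeasurableSpace Ξ} (μ : Measure Ξ) (𝒢 : Filtration ℕ mΞ)
    (r : Ξ → M.Trace) : Prop where
  forward_meas : ∀ k, ∀ t ≤ T, ∀ ω, Measurable[𝒢 k] fun ξ => (r ξ).x k t ω
  sample_meas : ∀ k ω, MeasurableSet[𝒢 (k + 1)] {ξ | (r ξ).sample k = ω}
  backward_meas : ∀ k, ∀ t < T, ∀ w,
    Measurable[𝒢 (k + 1)] fun ξ => (r ξ).subgrad k (t + 1) w
  sample_law : ∀ k ω (E : Set Ξ), MeasurableSet[𝒢 k] E →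
    μ (E ∩ {ξ | (r ξ).sample k = ω}) = μ E * ENNReal.ofReal (M.prob ω)

end StochLP

end

/-!
Finite convergence rests on the fact that the backward pass can produce only finitely many cuts. A
dual basic solution is determined by which of its variables vanish and which constraints are tight;
with the slopes of the next stage confined to a finite set, only finitely many multipliers arise,
however many cuts the linear program contains (`finite_dualBasic`). So all slopes lie in a finite
set, by backward induction over the stages. No duality theorem is needed for the intercepts: a cut
is a tangent of the expected next-stage value, and a function has at most one tangent of a given
slope (`IsRun.cut_eq_cut`). Hence finitely many approximations `V̄` arise in all executions and
iterations (`finite_range_Vbar`), and since they increase they are eventually constant along every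
execution (`eventually_Vbar_eq`).

With `V̄` fixed, the stage objectives are maxima of finitely many affine functions over polyhedra
`{x ≥ 0 : A x = b - R}`. Finitely many directions, one for each pattern of zero coordinates and
active pieces, improve every non-minimizer at unit rate, whatever `R` is. Visited states being
bounded, a quadratic penalty with a small coefficient cannot offset this rate, so the regularized
decisions eventually minimize the unregularized objectives
(`IsMaxAffine.exists_exact_regularization`).

It remains to treat the scenarios that are not sampled. If at the state reached by the forward
policy along `ω` the approximation lies strictly below the expected next-stage value (a gap), then
sampling `ω` changes `V̄`. Gaps are events of the past of an iteration, because `V̄` takes finitely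
many values and linear programming values are Borel functions of the right-hand side; so by Lévy's
conditional Borel–Cantelli lemma, gaps occur only finitely often almost surely
(`ae_eventually_not_hasGap`). Without gaps, and with `V̄ ≤ V*` on reachable states
(`IsRun.Vbar_le_Vstar`), backward induction along the Markov process shows that `V̄` and `V*` give
the same stage values at all visited states and that the decisions minimize the `V*`-objectives
(`IsRun.stageMin_eq_and_isMinOn`), which makes the policy optimal (`isOptimalPolicy_of_isMinOn`).
-/

/-! ### Maxima of finitely many affine functions -/

/-- `f` is the maximum of finitely many affine functions `x ↦ a + ⟨g, x⟩`, the pairs `(a, g)`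
being the elements of the finite set `s`. -/
def IsMaxAffine {d : ℕ} (f : (Fin d → ℝ) → ℝ) : Prop :=
  ∃ s : Finset (ℝ × (Fin d → ℝ)), ∀ x,
    (∀ p ∈ s, p.1 + p.2 ⬝ᵥ x ≤ f x) ∧ ∃ p ∈ s, f x = p.1 + p.2 ⬝ᵥ x

namespace IsMaxAffine

variable {d q : ℕ} {f f' : (Fin d → ℝ) → ℝ}

theorem affine (a : ℝ) (g : Fin d → ℝ) : IsMaxAffine fun x => a + g ⬝ᵥ x :=
  ⟨{(a, g)}, fun x => by simp⟩

theorem max (hf : IsMaxAffine f) (hf' : IsMaxAffine f') : IsMaxAffine fun x => max (f x) (f' x) := by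
  classical
  obtain ⟨s, hs⟩ := hf
  obtain ⟨s', hs'⟩ := hf'
  refine ⟨s ∪ s', fun x => ⟨fun p hp => ?_, ?_⟩⟩
  · rcases Finset.mem_union.1 hp with h | h
    · exact le_max_of_le_left ((hs x).1 p h)
    · exact le_max_of_le_right ((hs' x).1 p h)
  · obtain ⟨p, hp, h⟩ := (hs x).2
    obtain ⟨p', hp', h'⟩ := (hs' x).2
    rcases le_total (f x) (f' x) with hle | hle
    · exact ⟨p', Finset.mem_union_right _ hp', (max_eq_right hle).trans h'⟩
    · exact ⟨p, Finset.mem_union_left _ hp, (max_eq_left hle).trans h⟩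

theorem continuous (hf : IsMaxAffine f) : Continuous f := by
  obtain ⟨s, hs⟩ := hf
  have hne : s.Nonempty := let ⟨p, hp, _⟩ := (hs 0).2; ⟨p, hp⟩
  have : f = fun x => s.sup' hne fun p => p.1 + p.2 ⬝ᵥ x := by
    funext x
    obtain ⟨p, hp, h⟩ := (hs x).2
    exact le_antisymm (h ▸ Finset.le_sup' (fun p : ℝ × (Fin d → ℝ) => p.1 + p.2 ⬝ᵥ x) hp)
      (Finset.sup'_le _ _ (hs x).1)
  rw [this]
  exact Continuous.finset_sup'_apply hne fun p _ =>
    continuous_const.add (continuous_const.dotProduct continuous_id)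

theorem linear_add_comp (hf : IsMaxAffine f) (c : Fin q → ℝ) (B : Matrix (Fin d) (Fin q) ℝ) :
    IsMaxAffine fun x => c ⬝ᵥ x + f (B *ᵥ x) := by
  classical
  obtain ⟨s, hs⟩ := hf
  have key : ∀ (p : ℝ × (Fin d → ℝ)) (x : Fin q → ℝ),
      p.1 + (c + p.2 ᵥ* B) ⬝ᵥ x = c ⬝ᵥ x + (p.1 + p.2 ⬝ᵥ B *ᵥ x) := fun p x => by
    rw [add_dotProduct, Matrix.dotProduct_mulVec]; ring
  refine ⟨s.image fun p => (p.1, c + p.2 ᵥ* B), fun x => ⟨fun p hp => ?_, ?_⟩⟩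
  · obtain ⟨p', hp', rfl⟩ := Finset.mem_image.1 hp
    have := (hs (B *ᵥ x)).1 p' hp'
    rw [key]; linarith
  · obtain ⟨p, hp, h⟩ := (hs (B *ᵥ x)).2
    exact ⟨_, Finset.mem_image_of_mem _ hp, by rw [key, ← h]⟩

/-- A finite set of directions suffices to improve every non-minimizer of a max-affine function
over any of the polyhedra `{x ≥ 0 : A x = r}`, at unit rate and uniformly in `r`: whether a
direction is feasible and decreases the function to first order depends only on the zero
coordinates of `x` and on the affine pieces active at `x`, and there are finitely many such
patterns. -/
theorem exists_finset_descent (hf : IsMaxAffine f) (A : Matrix (Fin q) (Fin d) ℝ) :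
    ∃ U : Finset (Fin d → ℝ), ∀ x, 0 ≤ x →
      (∃ y, 0 ≤ y ∧ A *ᵥ y = A *ᵥ x ∧ f y < f x) →
      ∃ u ∈ U, ∀ᶠ ε in 𝓝[>] (0 : ℝ),
        0 ≤ x + ε • u ∧ A *ᵥ (x + ε • u) = A *ᵥ x ∧ f (x + ε • u) ≤ f x - ε := by
  classical
  obtain ⟨s, hs⟩ := hf
  let Dir : Finset (Fin d) × Finset (ℝ × (Fin d → ℝ)) → (Fin d → ℝ) → Prop := fun N u =>
    A *ᵥ u = 0 ∧ (∀ j ∈ N.1, 0 ≤ u j) ∧ ∀ p ∈ N.2, p.2 ⬝ᵥ u ≤ -1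
  let pick : Finset (Fin d) × Finset (ℝ × (Fin d → ℝ)) → (Fin d → ℝ) := fun N =>
    if h : ∃ u, Dir N u then h.choose else 0
  refine ⟨(Finset.univ ×ˢ s.powerset).image pick, ?_⟩
  rintro x hx ⟨y, hy, hAy, hfy⟩
  let N : Finset (Fin d) × Finset (ℝ × (Fin d → ℝ)) :=
    (Finset.univ.filter fun j => x j = 0, s.filter fun p => p.1 + p.2 ⬝ᵥ x = f x)
  have hpos : 0 < f x - f y := sub_pos.2 hfy
  have hex : ∃ u, Dir N u := by
    refine ⟨(f x - f y)⁻¹ • (y - x), ?_, ?_, ?_⟩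
    · rw [Matrix.mulVec_smul, Matrix.mulVec_sub, hAy, sub_self, smul_zero]
    · intro j hj
      have hj0 : x j = 0 := (Finset.mem_filter.1 hj).2
      have := hy j
      simp only [Pi.smul_apply, Pi.sub_apply, hj0, sub_zero, smul_eq_mul]
      exact mul_nonneg (inv_nonneg.2 hpos.le) this
    · intro p hp
      obtain ⟨hps, hpx⟩ := Finset.mem_filter.1 hp
      have := (hs y).1 p hps
      rw [dotProduct_smul, dotProduct_sub, smul_eq_mul, inv_mul_le_iff₀ hpos]
      linarith
  have hu : Dir N (pick N) := by
    simp only [pick, dif_pos hex]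
    exact hex.choose_spec
  refine ⟨pick N, Finset.mem_image_of_mem _ (Finset.mem_product.2
    ⟨Finset.mem_univ _, Finset.mem_powerset.2 (Finset.filter_subset _ _)⟩), ?_⟩
  generalize pick N = u at hu
  obtain ⟨hAu, hNu, hSu⟩ := hu
  have hfeas : ∀ j, ∀ᶠ ε in 𝓝[>] (0 : ℝ), 0 ≤ (x + ε • u) j := by
    intro j
    rcases (hx j).eq_or_lt with h0 | h0
    · filter_upwards [self_mem_nhdsWithin] with ε hε
      have h1 : 0 ≤ u j := hNu j (Finset.mem_filter.2 ⟨Finset.mem_univ _, h0.symm⟩)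
      have h2 : x j = 0 := h0.symm
      simp only [Pi.add_apply, Pi.smul_apply, smul_eq_mul, h2, zero_add]
      exact mul_nonneg (le_of_lt hε) h1
    · have hc : ContinuousAt (fun ε : ℝ => (x + ε • u) j) 0 := by
        simp only [Pi.add_apply, Pi.smul_apply]; fun_prop
      have h1 : (0 : ℝ) < (x + (0 : ℝ) • u) j := by simpa using h0
      exact ((hc.eventually (lt_mem_nhds h1)).filter_mono nhdsWithin_le_nhds).mono
        fun ε hε => hε.le
  have hval : ∀ p ∈ s, ∀ᶠ ε in 𝓝[>] (0 : ℝ), p.1 + p.2 ⬝ᵥ (x + ε • u) ≤ f x - ε := by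
    intro p hp
    have hexp : ∀ ε : ℝ, p.1 + p.2 ⬝ᵥ (x + ε • u) = p.1 + p.2 ⬝ᵥ x + ε * (p.2 ⬝ᵥ u) := fun ε => by
      rw [dotProduct_add, dotProduct_smul, smul_eq_mul]; ring
    rcases ((hs x).1 p hp).eq_or_lt with h0 | h0
    · filter_upwards [self_mem_nhdsWithin] with ε hε
      have h1 := hSu p (Finset.mem_filter.2 ⟨hp, h0⟩)
      have hε' : (0 : ℝ) < ε := hε
      rw [hexp, h0]
      nlinarith
    · have hc : ContinuousAt (fun ε : ℝ => p.1 + p.2 ⬝ᵥ x + ε * (p.2 ⬝ᵥ u) + ε) 0 := by fun_prop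
      have h1 : p.1 + p.2 ⬝ᵥ x + (0 : ℝ) * (p.2 ⬝ᵥ u) + 0 < f x := by simpa using h0
      refine ((hc.eventually (gt_mem_nhds h1)).filter_mono nhdsWithin_le_nhds).mono fun ε hε => ?_
      rw [hexp]; linarith
  filter_upwards [eventually_all.2 hfeas, (Filter.eventually_all_finset s).2 hval] with ε h1 h2
  refine ⟨h1, ?_, ?_⟩
  · rw [Matrix.mulVec_add, Matrix.mulVec_smul, hAu, smul_zero, add_zero]
  · obtain ⟨p, hp, h⟩ := (hs (x + ε • u)).2
    exact h ▸ h2 p hp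

/-- Exact regularization: if the penalty coefficient is below a threshold that does not depend on
the right-hand side of the constraints, nor on the proximal centre as long as it stays within a
fixed distance, then every minimizer of the regularized problem minimizes `f` itself. -/
theorem exists_exact_regularization {m e : ℕ} (hf : IsMaxAffine f) (A : Matrix (Fin m) (Fin d) ℝ)
    (B : Matrix (Fin e) (Fin d) ℝ) (Q : Matrix (Fin e) (Fin e) ℝ) (N : ℝ) :
    ∃ ρ₀ > 0, ∀ ρ, 0 ≤ ρ → ρ < ρ₀ → ∀ (R b : Fin m → ℝ) (R₀ : Fin e → ℝ) (x : Fin d → ℝ),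
      0 ≤ x → R + A *ᵥ x = b → ‖B *ᵥ x - R₀‖ ≤ N →
      IsMinOn (fun y => f y + ρ / 2 * ((B *ᵥ y - R₀) ⬝ᵥ (Q *ᵥ (B *ᵥ y - R₀))))
        {y | 0 ≤ y ∧ R + A *ᵥ y = b} x →
      IsMinOn f {y | 0 ≤ y ∧ R + A *ᵥ y = b} x := by
  obtain ⟨U, hU⟩ := hf.exists_finset_descent A
  -- `ε * slope u v ε` is the variation of the quadratic form from `v` to `v + ε • B u`.
  let slope : (Fin d → ℝ) → (Fin e → ℝ) × ℝ → ℝ := fun u z =>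
    z.1 ⬝ᵥ (Q *ᵥ (B *ᵥ u)) + (B *ᵥ u) ⬝ᵥ (Q *ᵥ z.1) + z.2 * ((B *ᵥ u) ⬝ᵥ (Q *ᵥ (B *ᵥ u)))
  have hbound : ∃ C : ℝ, 0 < C ∧ ∀ u ∈ U, ∀ v : Fin e → ℝ, ‖v‖ ≤ N → ∀ ε ∈ Set.Icc (0 : ℝ) 1,
      slope u (v, ε) ≤ C := by
    have h1 : ∀ u, ∃ C : ℝ, ∀ z ∈ Metric.closedBall (0 : Fin e → ℝ) N ×ˢ Set.Icc (0 : ℝ) 1,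
        slope u z ≤ C := by
      intro u
      have hc : Continuous (slope u) :=
        ((continuous_fst.dotProduct continuous_const).add
          (continuous_const.dotProduct (continuous_const.matrix_mulVec continuous_fst))).add
          (continuous_snd.mul continuous_const)
      obtain ⟨C, hC⟩ := (((isCompact_closedBall (0 : Fin e → ℝ) N).prod
        (isCompact_Icc (a := (0 : ℝ)) (b := 1))).image hc).bddAbove
      exact ⟨C, fun z hz => hC (Set.mem_image_of_mem _ hz)⟩
    choose C hC using h1
    obtain ⟨D, hD⟩ := (U.image C).bddAbove
    refine ⟨Max.max D 1, by positivity, fun u hu v hv ε hε => ?_⟩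
    exact (hC u (v, ε) ⟨by simpa using hv, hε⟩).trans
      ((hD (Finset.mem_coe.2 (Finset.mem_image_of_mem _ hu))).trans (le_max_left _ _))
  obtain ⟨C, hC0, hC⟩ := hbound
  refine ⟨2 / C, by positivity, fun ρ hρ0 hρ R b R₀ x hx hxb hN hmin => ?_⟩
  intro y hy
  by_contra hlt
  have hlt : f y < f x := not_le.1 hlt
  obtain ⟨u, huU, hu⟩ := hU x hx ⟨y, hy.1, add_left_cancel (hy.2.trans hxb.symm), hlt⟩
  have hIoo : ∀ᶠ ε in 𝓝[>] (0 : ℝ), ε ∈ Set.Ioo (0 : ℝ) 1 := Ioo_mem_nhdsGT one_pos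
  obtain ⟨ε, ⟨h1, h2, h3⟩, hε0, hε1⟩ := (hu.and hIoo).exists
  have h4 := hmin (show x + ε • u ∈ {y | 0 ≤ y ∧ R + A *ᵥ y = b} from ⟨h1, by rw [h2, hxb]⟩)
  have h5 := hC u huU (B *ᵥ x - R₀) hN ε ⟨hε0.le, hε1.le⟩
  have h6 : (B *ᵥ (x + ε • u) - R₀) ⬝ᵥ (Q *ᵥ (B *ᵥ (x + ε • u) - R₀)) =
      (B *ᵥ x - R₀) ⬝ᵥ (Q *ᵥ (B *ᵥ x - R₀)) + ε * slope u (B *ᵥ x - R₀, ε) := by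
    have : B *ᵥ (x + ε • u) - R₀ = (B *ᵥ x - R₀) + ε • (B *ᵥ u) := by
      rw [Matrix.mulVec_add, Matrix.mulVec_smul]; abel
    rw [this]
    simp only [slope, Matrix.mulVec_add, Matrix.mulVec_smul, add_dotProduct, dotProduct_add,
      smul_dotProduct, dotProduct_smul, smul_eq_mul]
    ring
  simp only [Set.mem_ofPred_eq] at h4
  rw [h6] at h4
  have h7 : ρ * C < 2 := (lt_div_iff₀ hC0).1 hρ
  have h8 : ρ / 2 * (ε * slope u (B *ᵥ x - R₀, ε)) ≤ ρ / 2 * (ε * C) :=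
    mul_le_mul_of_nonneg_left (mul_le_mul_of_nonneg_left h5 hε0.le) (by positivity)
  nlinarith

end IsMaxAffine

/-! ### Polyhedra `{x ≥ 0 : R + A x = b}` -/

section Polyhedron

variable {m n : ℕ} (A : Matrix (Fin m) (Fin n) ℝ) (b : Fin m → ℝ)

theorem isClosed_polyhedron (R : Fin m → ℝ) :
    IsClosed {x : Fin n → ℝ | 0 ≤ x ∧ R + A *ᵥ x = b} :=
  (isClosed_le continuous_const continuous_id).inter
    (isClosed_eq (continuous_const.add (continuous_const.matrix_mulVec continuous_id))
      continuous_const)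

/-- Bounded polyhedra with a common matrix are bounded uniformly for bounded right-hand sides,
because the recession cone `{x ≥ 0 : A x = 0}` is trivial. -/
theorem exists_norm_le_of_isBounded
    (hb : ∀ R, Bornology.IsBounded {x : Fin n → ℝ | 0 ≤ x ∧ R + A *ᵥ x = b}) (N : ℝ) :
    ∃ N' : ℝ, ∀ R x, ‖R‖ ≤ N → 0 ≤ x → R + A *ᵥ x = b → ‖x‖ ≤ N' := by
  have hrec : ∀ x : Fin n → ℝ, 0 ≤ x → A *ᵥ x = 0 → x = 0 := by
    intro x hx hAx
    by_contra hne
    obtain ⟨D, hD⟩ := (hb b).exists_norm_le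
    have h0 : 0 < ‖x‖ := norm_pos_iff.2 hne
    have hs : 0 ≤ (|D| + 1) / ‖x‖ := by positivity
    have := hD (((|D| + 1) / ‖x‖) • x)
      ⟨smul_nonneg hs hx, by rw [Matrix.mulVec_smul, hAx, smul_zero, add_zero]⟩
    rw [norm_smul, Real.norm_of_nonneg hs, div_mul_cancel₀ _ h0.ne'] at this
    linarith [le_abs_self D]
  have hcpt : IsCompact {x : Fin n → ℝ | 0 ≤ x ∧ ‖x‖ = 1} := by
    refine (isCompact_sphere (0 : Fin n → ℝ) 1).of_isClosed_subset
      ((isClosed_le continuous_const continuous_id).inter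
        (isClosed_eq continuous_norm continuous_const)) ?_
    rintro x ⟨_, hx⟩
    simpa using hx
  have hδ : ∃ δ > 0, ∀ x : Fin n → ℝ, 0 ≤ x → ‖x‖ = 1 → δ ≤ ‖A *ᵥ x‖ := by
    rcases Set.eq_empty_or_nonempty {x : Fin n → ℝ | 0 ≤ x ∧ ‖x‖ = 1} with he | hne
    · refine ⟨1, one_pos, fun x h1 h2 => ?_⟩
      have : x ∈ {x : Fin n → ℝ | 0 ≤ x ∧ ‖x‖ = 1} := ⟨h1, h2⟩
      simp [he] at this
    · obtain ⟨x₀, ⟨h1, h2⟩, hmin⟩ := hcpt.exists_isMinOn hne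
        (continuous_const.matrix_mulVec continuous_id : Continuous fun x => A *ᵥ x).norm.continuousOn
      refine ⟨‖A *ᵥ x₀‖, norm_pos_iff.2 fun h => ?_, fun x hx hx1 => hmin ⟨hx, hx1⟩⟩
      rw [hrec x₀ h1 h, norm_zero] at h2
      exact zero_ne_one h2
  obtain ⟨δ, hδ0, hδ⟩ := hδ
  refine ⟨(‖b‖ + N) / δ, fun R x hR hx hRx => ?_⟩
  rw [le_div_iff₀ hδ0]
  have hAx : ‖A *ᵥ x‖ ≤ ‖b‖ + N := by
    rw [← sub_eq_of_eq_add' hRx.symm]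
    exact (norm_sub_le _ _).trans (by linarith)
  rcases eq_or_ne x 0 with rfl | hne
  · simpa using (norm_nonneg _).trans hAx
  · have h0 : 0 < ‖x‖ := norm_pos_iff.2 hne
    have := hδ (‖x‖⁻¹ • x) (smul_nonneg (inv_nonneg.2 h0.le) hx)
      (by rw [norm_smul, norm_inv, norm_norm, inv_mul_cancel₀ h0.ne'])
    rw [Matrix.mulVec_smul, norm_smul, norm_inv, norm_norm, inv_mul_eq_div, le_div_iff₀ h0] at this
    linarith

/-- The optimal value as a function of the right-hand side is Borel measurable: its strict
sublevel sets are, up to the empty-polyhedron case, linear images of `σ`-compact sets. -/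
theorem measurable_sInf_polyhedron
    (hb : ∀ R, Bornology.IsBounded {x : Fin n → ℝ | 0 ≤ x ∧ R + A *ᵥ x = b})
    {f : (Fin n → ℝ) → ℝ} (hf : Continuous f) :
    Measurable fun R => sInf (f '' {x : Fin n → ℝ | 0 ≤ x ∧ R + A *ᵥ x = b}) := by
  have hcl : ∀ c : ℝ, MeasurableSet {R | ∃ x : Fin n → ℝ, 0 ≤ x ∧ R + A *ᵥ x = b ∧ f x ≤ c} := by
    intro c
    have : {R | ∃ x : Fin n → ℝ, 0 ≤ x ∧ R + A *ᵥ x = b ∧ f x ≤ c} =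
        ⋃ k : ℕ, (fun x => b - A *ᵥ x) ''
          (Metric.closedBall 0 k ∩ {x : Fin n → ℝ | 0 ≤ x ∧ f x ≤ c}) := by
      ext R
      simp only [Set.mem_ofPred_eq, Set.mem_iUnion, Set.mem_image, Set.mem_inter_iff,
        mem_closedBall_zero_iff]
      constructor
      · rintro ⟨x, h1, h2, h3⟩
        obtain ⟨k, hk⟩ := exists_nat_ge ‖x‖
        exact ⟨k, x, ⟨hk, h1, h3⟩, by rw [← h2, add_sub_cancel_right]⟩
      · rintro ⟨k, x, ⟨_, h1, h3⟩, rfl⟩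
        exact ⟨x, h1, sub_add_cancel _ _, h3⟩
    rw [this]
    refine MeasurableSet.iUnion fun k => IsCompact.measurableSet ?_
    exact ((isCompact_closedBall _ _).inter_right
      ((isClosed_le continuous_const continuous_id).inter (isClosed_le hf continuous_const))).image
      (continuous_const.sub (continuous_const.matrix_mulVec continuous_id))
  have hbdd : ∀ R, BddBelow (f '' {x : Fin n → ℝ | 0 ≤ x ∧ R + A *ᵥ x = b}) := fun R =>
    ((Metric.isCompact_of_isClosed_isBounded (isClosed_polyhedron A b R) (hb R)).image hf).bddBelow
  have hlt : ∀ c : ℝ, MeasurableSet {R | ∃ x : Fin n → ℝ, 0 ≤ x ∧ R + A *ᵥ x = b ∧ f x < c} := by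
    intro c
    have : {R | ∃ x : Fin n → ℝ, 0 ≤ x ∧ R + A *ᵥ x = b ∧ f x < c} =
        ⋃ k : ℕ, {R | ∃ x : Fin n → ℝ, 0 ≤ x ∧ R + A *ᵥ x = b ∧ f x ≤ c - 1 / ((k : ℝ) + 1)} := by
      ext R
      simp only [Set.mem_ofPred_eq, Set.mem_iUnion]
      constructor
      · rintro ⟨x, h1, h2, h3⟩
        obtain ⟨k, hk⟩ := exists_nat_one_div_lt (sub_pos.2 h3)
        exact ⟨k, x, h1, h2, by linarith⟩
      · rintro ⟨k, x, h1, h2, h3⟩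
        exact ⟨x, h1, h2, h3.trans_lt (sub_lt_self _ (by positivity))⟩
    rw [this]
    exact MeasurableSet.iUnion fun k => hcl _
  have hdom : MeasurableSet {R | ∃ x : Fin n → ℝ, 0 ≤ x ∧ R + A *ᵥ x = b} := by
    have : {R | ∃ x : Fin n → ℝ, 0 ≤ x ∧ R + A *ᵥ x = b} =
        ⋃ k : ℕ, {R | ∃ x : Fin n → ℝ, 0 ≤ x ∧ R + A *ᵥ x = b ∧ f x ≤ k} := by
      ext R
      simp only [Set.mem_ofPred_eq, Set.mem_iUnion]
      constructor
      · rintro ⟨x, h1, h2⟩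
        obtain ⟨k, hk⟩ := exists_nat_ge (f x)
        exact ⟨k, x, h1, h2, hk⟩
      · rintro ⟨k, x, h1, h2, _⟩
        exact ⟨x, h1, h2⟩
    rw [this]
    exact MeasurableSet.iUnion fun k => hcl _
  refine measurable_of_Iio fun c => ?_
  have : (fun R => sInf (f '' {x : Fin n → ℝ | 0 ≤ x ∧ R + A *ᵥ x = b})) ⁻¹' Set.Iio c =
      {R | ∃ x : Fin n → ℝ, 0 ≤ x ∧ R + A *ᵥ x = b ∧ f x < c} ∪
        ({R | ∃ x : Fin n → ℝ, 0 ≤ x ∧ R + A *ᵥ x = b}ᶜ ∩ {_R | 0 < c}) := by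
    ext R
    simp only [Set.mem_preimage, Set.mem_Iio, Set.mem_union, Set.mem_inter_iff, Set.mem_compl_iff,
      Set.mem_ofPred_eq]
    by_cases hne : ∃ x : Fin n → ℝ, 0 ≤ x ∧ R + A *ᵥ x = b
    · rw [csInf_lt_iff (hbdd R) (Set.Nonempty.image f hne)]
      simp [hne, and_assoc]
    · have he : {x : Fin n → ℝ | 0 ≤ x ∧ R + A *ᵥ x = b} = ∅ :=
        Set.eq_empty_of_forall_notMem fun x hx => hne ⟨x, hx⟩
      have h2 : ¬ ∃ x : Fin n → ℝ, 0 ≤ x ∧ R + A *ᵥ x = b ∧ f x < c :=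
        fun ⟨x, h1, h2, _⟩ => hne ⟨x, h1, h2⟩
      simp only [he, Set.image_empty, Real.sInf_empty, h2, hne, not_false_eq_true, true_and,
        false_or]
  rw [this]
  exact (hlt c).union (hdom.compl.inter (MeasurableSet.const _))

end Polyhedron

/-! ### Finitely many slopes from dual basic solutions -/

open StochLP in
/-- A basic dual solution is determined by the set of its nonzero `y`-coordinates, the set of
slopes that carry weight and the set of tight constraints. Hence only finitely many multipliers
`y` arise when all slopes lie in a fixed finite set, however many cuts the problem has. -/
theorem finite_dualBasic {p q d : ℕ} (A : Matrix (Fin p) (Fin q) ℝ) (B : Matrix (Fin d) (Fin q) ℝ)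
    (c : Fin q → ℝ) {G : Set (Fin d → ℝ)} (hG : G.Finite) :
    {y : Fin p → ℝ | ∃ (ι : Type) (_ : Fintype ι) (g : ι → Fin d → ℝ) (z : ι → ℝ),
      (∀ i, g i ∈ G) ∧ DualFeasible A B c g y z ∧ DualBasic A B c g y z}.Finite := by
  classical
  set S := {y : Fin p → ℝ | ∃ (ι : Type) (_ : Fintype ι) (g : ι → Fin d → ℝ) (z : ι → ℝ),
      (∀ i, g i ∈ G) ∧ DualFeasible A B c g y z ∧ DualBasic A B c g y z}
  choose ι hι g z hg hfeas hbas using fun y : S => y.2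
  let pat : S → Set (Fin p) × Set (Fin d → ℝ) × Set (Fin q) := fun y =>
    ({i | y.1 i = 0}, {γ | ∃ i, z y i ≠ 0 ∧ g y i = γ}, {l | dualLhs A B (g y) y.1 (z y) l = c l})
  have hfin : (pat '' Set.univ).Finite := by
    refine ((Set.finite_univ (α := Set (Fin p))).prod
      (hG.finite_subsets.prod (Set.finite_univ (α := Set (Fin q))))).subset ?_
    rintro _ ⟨y, -, rfl⟩
    refine ⟨Set.mem_univ _, ?_, Set.mem_univ _⟩
    rintro γ ⟨i, _, rfl⟩
    exact hg y i
  refine Set.finite_coe_iff.1 (Set.finite_univ_iff.1 (Set.Finite.of_finite_image hfin ?_))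
  intro y₁ _ y₂ _ heq
  have hy0 : ∀ i, y₁.1 i = 0 → y₂.1 i = 0 := fun i hi =>
    (Set.ext_iff.1 (congrArg Prod.fst heq) i).1 hi
  have hz0 : ∀ i, z y₂ i ≠ 0 → ∃ i', z y₁ i' ≠ 0 ∧ g y₁ i' = g y₂ i := fun i hi =>
    (Set.ext_iff.1 (congrArg (fun P => P.2.1) heq) (g y₂ i)).2
      (show g y₂ i ∈ {γ | ∃ i, z y₂ i ≠ 0 ∧ g y₂ i = γ} from ⟨i, hi, rfl⟩)
  have ht : ∀ l, dualLhs A B (g y₁) y₁.1 (z y₁) l = c l →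
      dualLhs A B (g y₂) y₂.1 (z y₂) l = c l :=
    fun l hl => (Set.ext_iff.1 (congrArg (fun P => P.2.2) heq) l).1 hl
  obtain ⟨-, -, hs₁⟩ := hfeas y₁
  obtain ⟨-, -, hs₂⟩ := hfeas y₂
  have hne : Nonempty (ι y₁) := by
    by_contra hemp
    rw [not_nonempty_iff] at hemp
    simp at hs₁
  -- The weights of the second solution are moved to indices of the first with the same slopes.
  have hφ : ∃ φ : ι y₂ → ι y₁, ∀ i, z y₂ i ≠ 0 → z y₁ (φ i) ≠ 0 ∧ g y₁ (φ i) = g y₂ i := by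
    refine ⟨fun i => if h : z y₂ i ≠ 0 then (hz0 i h).choose else Classical.arbitrary _,
      fun i hi => ?_⟩
    simp only [dif_pos hi]
    exact (hz0 i hi).choose_spec
  obtain ⟨φ, hφ⟩ := hφ
  let w : ι y₁ → ℝ := fun i' => ∑ i, if φ i = i' then z y₂ i else 0
  have hw1 : ∑ i', w i' = 1 := by
    rw [Finset.sum_comm, ← hs₂]
    exact Finset.sum_congr rfl fun i _ => by simp
  have hwg : ∑ i', w i' • g y₁ i' = ∑ i, z y₂ i • g y₂ i := by
    simp only [w, Finset.sum_smul]
    rw [Finset.sum_comm]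
    refine Finset.sum_congr rfl fun i _ => ?_
    simp only [ite_smul, zero_smul, Finset.sum_ite_eq, Finset.mem_univ, if_true]
    by_cases hi : z y₂ i = 0
    · simp [hi]
    · rw [(hφ i hi).2]
  have hlhs : dualLhs A B (g y₁) (y₁.1 - y₂.1) (z y₁ - w) =
      dualLhs A B (g y₁) y₁.1 (z y₁) - dualLhs A B (g y₂) y₂.1 (z y₂) := by
    simp only [dualLhs, Pi.sub_apply, sub_smul, Finset.sum_sub_distrib, hwg, Matrix.mulVec_sub]
    abel
  have := hbas y₁ (y₁.1 - y₂.1) (z y₁ - w)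
    (fun i hi => by simp [hi, hy0 i hi])
    (fun i' hi' => by
      have : w i' = 0 := Finset.sum_eq_zero fun i _ => by
        by_cases h : φ i = i'
        · rw [if_pos h]
          by_contra hi
          exact (hφ i hi).1 (h ▸ hi')
        · rw [if_neg h]
      simp [hi', this])
    (by simp [hs₁, hw1])
    (fun l hl => by rw [hlhs, Pi.sub_apply, hl, ht l hl, sub_self])
  exact Subtype.ext (sub_eq_zero.1 this.1)

/-! ### Finitely valued functions -/

theorem Set.Finite.range_of_factor {α β γ : Type*} {g : α → β} {h : α → γ}
    (hg : (Set.range g).Finite) (hgh : ∀ a a', g a = g a' → h a = h a') :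
    (Set.range h).Finite := by
  rcases isEmpty_or_nonempty α with hα | hα
  · rw [Set.range_eq_empty]; exact Set.finite_empty
  · refine (hg.image (h ∘ Function.invFun g)).subset ?_
    rintro _ ⟨a, rfl⟩
    exact ⟨g a, ⟨a, rfl⟩, hgh _ _ (Function.invFun_eq ⟨a, rfl⟩)⟩

theorem Set.Finite.range_pi {α ι : Type*} [Finite ι] {β : ι → Type*} {g : (i : ι) → α → β i}
    (hg : ∀ i, (Set.range (g i)).Finite) : (Set.range fun a i => g i a).Finite :=
  (Set.Finite.pi' hg).subset (by rintro _ ⟨a, rfl⟩ i; exact ⟨a, rfl⟩)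

/-- A function with finitely many values whose level sets are measurable. No measurable structure
on the codomain is involved, so that the values may be functions. -/
structure IsFiniteValued {Ξ α : Type*} (m : MeasurableSpace Ξ) (h : Ξ → α) : Prop where
  finite_range : (Set.range h).Finite
  level : ∀ a, MeasurableSet[m] (h ⁻¹' {a})

namespace IsFiniteValued

variable {Ξ α β : Type*} {m : MeasurableSpace Ξ} {g : Ξ → α} {h : Ξ → β}

theorem preimage (hg : IsFiniteValued m g) (S : Set α) : MeasurableSet[m] (g ⁻¹' S) := by
  have : g ⁻¹' S = ⋃ a ∈ S ∩ Set.range g, g ⁻¹' {a} := by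
    ext ξ; simp
  rw [this]
  exact MeasurableSet.biUnion (hg.finite_range.inter_of_right S).countable fun a _ => hg.level a

theorem factor (hg : IsFiniteValued m g) (hgh : ∀ ξ ξ', g ξ = g ξ' → h ξ = h ξ') :
    IsFiniteValued m h := by
  refine ⟨hg.finite_range.range_of_factor hgh, fun b => ?_⟩
  have : h ⁻¹' {b} = g ⁻¹' (g '' (h ⁻¹' {b})) := by
    refine (Set.subset_preimage_image _ _).antisymm ?_
    rintro ξ ⟨ξ', h1, h2⟩
    exact (hgh _ _ h2).symm.trans h1
  rw [this]
  exact hg.preimage _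

theorem mono {m' : MeasurableSpace Ξ} (hg : IsFiniteValued m g) (hm : m ≤ m') :
    IsFiniteValued m' g :=
  ⟨hg.finite_range, fun a => hm _ (hg.level a)⟩

theorem pi {ι : Type*} [Finite ι] {γ : ι → Type*} {f : (i : ι) → Ξ → γ i}
    (hf : ∀ i, IsFiniteValued m (f i)) : IsFiniteValued m fun ξ i => f i ξ := by
  refine ⟨Set.Finite.range_pi fun i => (hf i).finite_range, fun a => ?_⟩
  have : (fun ξ i => f i ξ) ⁻¹' {a} = ⋂ i, f i ⁻¹' {a i} := by
    ext ξ; simp [funext_iff]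
  rw [this]
  exact MeasurableSet.iInter fun i => (hf i).level _

theorem prodMk (hg : IsFiniteValued m g) (hh : IsFiniteValued m h) :
    IsFiniteValued m fun ξ => (g ξ, h ξ) := by
  refine ⟨(hg.finite_range.prod hh.finite_range).subset ?_, fun a => ?_⟩
  · rintro _ ⟨ξ, rfl⟩
    exact ⟨⟨ξ, rfl⟩, ξ, rfl⟩
  · have : (fun ξ => (g ξ, h ξ)) ⁻¹' {a} = g ⁻¹' {a.1} ∩ h ⁻¹' {a.2} := by
      ext ξ; simp [Prod.ext_iff]
    rw [this]
    exact (hg.level _).inter (hh.level _)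

end IsFiniteValued

theorem eventually_eq_of_monotone_of_finite_range {α : Type*} [PartialOrder α] {f : ℕ → α}
    (hf : Monotone f) (hfin : (Set.range f).Finite) : ∃ K, ∀ k ≥ K, f k = f K := by
  obtain ⟨_, ⟨K, rfl⟩, hK⟩ := hfin.exists_maximal (Set.range_nonempty f)
  exact ⟨K, fun k hk => le_antisymm (hK ⟨k, rfl⟩ (hf hk)) (hf hk)⟩

/-! ### A conditional Borel–Cantelli lemma -/

/-- If `S k` occurs with probability `p > 0` independently of the past `𝒢 k`, and the events
`A k ∈ 𝒢 k` almost surely coincide with `S k` only finitely often, then almost surely only finitely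
many of the `A k` occur. -/
theorem ae_eventually_notMem_of_inter {Ξ : Type*} {mΞ : MeasurableSpace Ξ} {μ : Measure Ξ}
    [IsProbabilityMeasure μ] {𝒢 : Filtration ℕ mΞ} {A S : ℕ → Set Ξ} {p : ℝ} (hp : 0 < p)
    (hA : ∀ k, MeasurableSet[𝒢 k] (A k)) (hS : ∀ k, MeasurableSet[𝒢 (k + 1)] (S k))
    (hlaw : ∀ k E, MeasurableSet[𝒢 k] E → μ (E ∩ S k) = μ E * ENNReal.ofReal p)
    (hfin : ∀ᵐ ξ ∂μ, ∀ᶠ k in atTop, ξ ∉ A k ∩ S k) :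
    ∀ᵐ ξ ∂μ, ∀ᶠ k in atTop, ξ ∉ A k := by
  let s : ℕ → Set Ξ := fun n => Nat.casesOn n ∅ fun k => A k ∩ S k
  have hs : ∀ n, MeasurableSet[𝒢 n] (s n) := by
    rintro (_ | k)
    · exact @MeasurableSet.empty _ (𝒢 0)
    · exact (𝒢.mono k.le_succ _ (hA k)).inter (hS k)
  have hcond : ∀ k, (A k).indicator (fun _ => p) =ᵐ[μ]
      μ[(s (k + 1)).indicator (1 : Ξ → ℝ) | 𝒢 k] := by
    intro k
    have hA' := 𝒢.le k _ (hA k)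
    have hs' := 𝒢.le (k + 1) _ (hs (k + 1))
    refine ae_eq_condExp_of_forall_setIntegral_eq (𝒢.le k) ?_ ?_ ?_ ?_
    · exact (integrable_const (1 : ℝ)).indicator hs'
    · exact fun E _ _ => ((integrable_const p).indicator hA').integrableOn
    · intro E hE _
      have hE' := 𝒢.le k _ hE
      rw [setIntegral_indicator hA', setIntegral_indicator hs']
      simp only [Pi.one_apply, setIntegral_const, smul_eq_mul, mul_one]
      have h1 : E ∩ s (k + 1) = (E ∩ A k) ∩ S k := (Set.inter_assoc _ _ _).symm
      rw [h1, measureReal_def, measureReal_def, hlaw k _ (hE.inter (hA k)), ENNReal.toReal_mul,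
        ENNReal.toReal_ofReal hp.le]
    · exact (stronglyMeasurable_const.indicator (hA k)).aestronglyMeasurable
  filter_upwards [ae_mem_limsup_atTop_iff μ hs, hfin, ae_all_iff.2 hcond] with ξ h1 h2 h3
  have h4 : ξ ∉ limsup s atTop := by
    rw [mem_limsup_iff_frequently_mem, not_frequently, ← map_add_atTop_eq_nat 1]
    exact h2
  have h5 : ξ ∉ limsup A atTop := by
    rw [Set.limsup_eq_tendsto_sum_indicator_atTop hp]
    rw [h1] at h4
    simpa only [Set.mem_ofPred_eq, h3] using h4
  rwa [mem_limsup_iff_frequently_mem, not_frequently] at h5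

namespace StochLP

variable {T : ℕ} {M : StochLP T}

/-! ### The information process -/

theorem P_nonneg (s : Set M.Scen) : 0 ≤ M.P s :=
  Finset.sum_nonneg fun ω _ => Set.indicator_nonneg (fun ω _ => M.prob_nonneg ω) ω

theorem trans_nonneg (t : ℕ) (j : M.Info t) (w : M.Obs (t + 1)) : 0 ≤ M.trans t j w :=
  div_nonneg (P_nonneg _) (P_nonneg _)

theorem IsMarkov.exists_scen (hM : M.IsMarkov) {t : ℕ} (ht : t < T) {ω : M.Scen}
    {w : M.Obs (t + 1)} (h : M.trans t (M.info t (M.obs t ω)) w ≠ 0) :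
    ∃ ω', (∀ s ≤ t, M.obs s ω' = M.obs s ω) ∧ M.obs (t + 1) ω' = w := by
  rw [← hM t ht, condP] at h
  have h1 := (div_ne_zero_iff.1 h).1
  obtain ⟨ω', -, h2⟩ := Finset.exists_ne_zero_of_sum_ne_zero h1
  have h3 := Set.mem_of_indicator_ne_zero h2
  exact ⟨ω', h3.2, h3.1⟩

/-- Tower property: averaging a function of the history and of the next observation over the
transition probabilities does not change its expectation. -/
theorem IsMarkov.sum_prob_mul_sum_trans (hM : M.IsMarkov) (hpos : ∀ ω, 0 < M.prob ω) {t : ℕ}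
    (ht : t < T) (φ : M.Scen → M.Obs (t + 1) → ℝ)
    (hφ : ∀ ω ω', (∀ s ≤ t, M.obs s ω = M.obs s ω') → φ ω = φ ω') :
    ∑ ω, M.prob ω * ∑ w, M.trans t (M.info t (M.obs t ω)) w * φ ω w =
      ∑ ω, M.prob ω * φ ω (M.obs (t + 1) ω) := by
  classical
  let H : M.Scen → Set M.Scen := fun ω => {ω' | ∀ s ≤ t, M.obs s ω' = M.obs s ω}
  have hHsymm : ∀ {ω ω'}, ω' ∈ H ω → ω ∈ H ω' := fun h s hs => (h s hs).symm
  have hHeq : ∀ {ω ω'}, ω' ∈ H ω → H ω' = H ω := fun {ω ω'} h => by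
    ext ω''
    exact forall₂_congr fun s hs => by rw [h s hs]
  have hHpos : ∀ ω, 0 < M.P (H ω) := fun ω => by
    have h1 : (H ω).indicator M.prob ω = M.prob ω :=
      Set.indicator_of_mem (show ω ∈ H ω from fun s _ => rfl) _
    exact (hpos ω).trans_le (h1 ▸ Finset.single_le_sum
      (f := fun ω' => (H ω).indicator M.prob ω')
      (fun ω' _ => Set.indicator_nonneg (fun _ _ => M.prob_nonneg _) _) (Finset.mem_univ ω))
  have h1 : ∀ ω, ∑ w, M.trans t (M.info t (M.obs t ω)) w * φ ω w =
      ∑ ω', (H ω).indicator M.prob ω' / M.P (H ω) * φ ω (M.obs (t + 1) ω') := by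
    intro ω
    have h2 : ∀ w, M.trans t (M.info t (M.obs t ω)) w * φ ω w =
        ∑ ω', if M.obs (t + 1) ω' = w then
          (H ω).indicator M.prob ω' / M.P (H ω) * φ ω (M.obs (t + 1) ω') else 0 := by
      intro w
      rw [← hM t ht, condP, P, Finset.sum_div, Finset.sum_mul]
      refine Finset.sum_congr rfl fun ω' _ => ?_
      by_cases hw : M.obs (t + 1) ω' = w
      · rw [if_pos hw, hw]
        congr 2
        by_cases hω : ω' ∈ H ω
        · rw [Set.indicator_of_mem hω,
            Set.indicator_of_mem (show ω' ∈ {ω | M.obs (t + 1) ω = w} ∩ H ω from ⟨hw, hω⟩)]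
        · rw [Set.indicator_of_notMem hω, Set.indicator_of_notMem fun h => hω h.2]
      · rw [if_neg hw, Set.indicator_of_notMem fun h => hw h.1, zero_div, zero_mul]
    simp_rw [h2]
    rw [Finset.sum_comm]
    exact Finset.sum_congr rfl fun ω' _ => by simp
  simp_rw [h1, Finset.mul_sum]
  rw [Finset.sum_comm]
  refine Finset.sum_congr rfl fun ω' _ => ?_
  have h3 : ∀ ω, M.prob ω * ((H ω).indicator M.prob ω' / M.P (H ω) * φ ω (M.obs (t + 1) ω')) =
      (H ω').indicator M.prob ω * (M.prob ω' / M.P (H ω') * φ ω' (M.obs (t + 1) ω')) := by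
    intro ω
    by_cases hω : ω' ∈ H ω
    · rw [Set.indicator_of_mem hω, Set.indicator_of_mem (hHsymm hω), hHeq hω, hφ ω' ω hω]
    · rw [Set.indicator_of_notMem hω, Set.indicator_of_notMem fun h => hω (hHsymm h)]
      simp
  simp_rw [h3]
  rw [← Finset.sum_mul]
  change M.P (H ω') * _ = _
  have := (hHpos ω').ne'
  field_simp

/-! ### Reachable resource states -/

/-- `M.Reach ω t R`: the incoming resource state `R` of stage `t` results from feasible decisions
of the earlier stages along `ω`. -/
def Reach (M : StochLP T) (ω : M.Scen) : (t : ℕ) → (Fin (M.m t) → ℝ) → Prop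
  | 0, R => R = 0
  | t + 1, R => ∃ R₀ x, M.Reach ω t R₀ ∧ x ∈ M.X t R₀ (M.obs t ω) ∧ R = M.B t (M.obs t ω) *ᵥ x

theorem Reach.congr {ω ω' : M.Scen} {t : ℕ} {R : Fin (M.m t) → ℝ} (hR : M.Reach ω t R)
    (h : ∀ s < t, M.obs s ω = M.obs s ω') : M.Reach ω' t R := by
  induction t with
  | zero => exact hR
  | succ t ih =>
    obtain ⟨R₀, x, h1, h2, h3⟩ := hR
    have ht := h t t.lt_succ_self
    exact ⟨R₀, x, ih h1 fun s hs => h s (hs.trans t.lt_succ_self), ht ▸ h2, ht ▸ h3⟩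

theorem resIn_congr {x x' : (t : ℕ) → (Fin (M.n t) → ℝ)} (ω : M.Scen) {t : ℕ}
    (h : ∀ s < t, x s = x' s) : M.resIn x ω t = M.resIn x' ω t := by
  cases t with
  | zero => rfl
  | succ t => simp only [resIn, h t t.lt_succ_self]

theorem Reach.exists_decisions {ω : M.Scen} {t : ℕ} {R : Fin (M.m t) → ℝ} (hR : M.Reach ω t R) :
    ∃ x : (s : ℕ) → (Fin (M.n s) → ℝ),
      (∀ s < t, x s ∈ M.X s (M.resIn x ω s) (M.obs s ω)) ∧ M.resIn x ω t = R := by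
  induction t with
  | zero => exact ⟨fun _ => 0, fun s hs => absurd hs s.not_lt_zero, hR.symm⟩
  | succ t ih =>
    obtain ⟨R₀, x₀, h1, h2, rfl⟩ := hR
    obtain ⟨x, hx, rfl⟩ := ih h1
    have hres : ∀ s ≤ t, M.resIn (Function.update x t x₀) ω s = M.resIn x ω s := fun s hs =>
      resIn_congr ω fun s' hs' => Function.update_of_ne (hs'.trans_le hs).ne _ _
    refine ⟨Function.update x t x₀, fun s hs => ?_, by simp [resIn]⟩
    rw [hres s (Nat.lt_succ_iff.1 hs)]
    rcases (Nat.lt_succ_iff.1 hs).eq_or_lt with rfl | hlt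
    · rwa [Function.update_self]
    · rw [Function.update_of_ne hlt.ne]
      exact hx s hlt

theorem Reach.nonempty_X (hrec : M.RelativelyCompleteRecourse) {ω : M.Scen} {t : ℕ} (ht : t < T)
    {R : Fin (M.m (t + 1)) → ℝ} (hR : M.Reach ω (t + 1) R) :
    (M.X (t + 1) R (M.obs (t + 1) ω)).Nonempty := by
  obtain ⟨x, hx, rfl⟩ := hR.exists_decisions
  exact hrec t ht ω x fun s hs => hx s (Nat.lt_succ_iff.2 hs)

theorem IsFeasiblePolicy.reach {y : M.Policy} (hy : M.IsFeasiblePolicy y) (ω : M.Scen) {t : ℕ}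
    (ht : t ≤ T + 1) : M.Reach ω t (M.state y ω t) := by
  induction t with
  | zero => rfl
  | succ t ih =>
    have ht' : t ≤ T := Nat.le_of_succ_le_succ ht
    exact ⟨_, _, ih (ht'.trans T.le_succ), hy.2 ω t ht', rfl⟩

theorem exists_norm_le_of_reach
    (hbdd : ∀ t ≤ T, ∀ (ω : M.Scen) (R : Fin (M.m t) → ℝ),
      Bornology.IsBounded (M.X t R (M.obs t ω))) {t : ℕ} (ht : t ≤ T + 1) :
    ∃ N : ℝ, ∀ ω R, M.Reach ω t R → ‖R‖ ≤ N := by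
  induction t with
  | zero =>
    refine ⟨0, fun ω R hR => ?_⟩
    rw [show R = 0 from hR, norm_zero]
  | succ t ih =>
    have ht' : t ≤ T := Nat.le_of_succ_le_succ ht
    obtain ⟨N, hN⟩ := ih (ht'.trans T.le_succ)
    have h1 : ∀ ω : M.Scen, ∃ N' : ℝ, ∀ R, M.Reach ω (t + 1) R → ‖R‖ ≤ N' := by
      intro ω
      obtain ⟨N', hN'⟩ := exists_norm_le_of_isBounded (M.A t (M.obs t ω)) (M.b t (M.obs t ω))
        (fun R => hbdd t ht' ω R) N
      obtain ⟨C, hC⟩ := ((isCompact_closedBall (0 : Fin (M.n t) → ℝ) N').image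
        (continuous_const.matrix_mulVec continuous_id :
          Continuous fun x => M.B t (M.obs t ω) *ᵥ x)).isBounded.exists_norm_le
      refine ⟨C, ?_⟩
      rintro _ ⟨R₀, x, h1, ⟨h2, h3⟩, rfl⟩
      exact hC _ ⟨x, by simpa using hN' R₀ x (hN ω R₀ h1) h2 h3, rfl⟩
    choose N' hN' using h1
    obtain ⟨C, hC⟩ := (Set.finite_range N').bddAbove
    exact ⟨C, fun ω R hR => (hN' ω R hR).trans (hC ⟨ω, rfl⟩)⟩

/-! ### Stage problems and the optimal value functions -/

theorem Vstar_self (j : M.Info T) (R : Fin (M.m (T + 1)) → ℝ) : M.Vstar T j R = 0 := by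
  simp [Vstar, costToGo]

theorem Vstar_eq {t : ℕ} (ht : t < T) (j : M.Info t) (R : Fin (M.m (t + 1)) → ℝ) :
    M.Vstar t j R = ∑ w, M.trans t j w * M.stageMin (t + 1) (M.Vstar (t + 1)) R w := by
  rw [Vstar, show T - t = (T - (t + 1)) + 1 by omega]
  rfl

theorem stageMin_congr {t : ℕ} {V V' : M.Info t → (Fin (M.m (t + 1)) → ℝ) → ℝ}
    {w : M.Obs t} (h : V (M.info t w) = V' (M.info t w)) (R : Fin (M.m t) → ℝ) :
    M.stageMin t V R w = M.stageMin t V' R w := by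
  have : M.obj t V w = M.obj t V' w := funext fun x => by rw [obj, obj, h]
  rw [stageMin, stageMin, this]

theorem stageMin_eq {t : ℕ} {V : M.Info t → (Fin (M.m (t + 1)) → ℝ) → ℝ} {R : Fin (M.m t) → ℝ}
    {w : M.Obs t} {x : Fin (M.n t) → ℝ} (hx : x ∈ M.X t R w)
    (hmin : IsMinOn (M.obj t V w) (M.X t R w) x) : M.stageMin t V R w = M.obj t V w x :=
  IsLeast.csInf_eq ⟨Set.mem_image_of_mem _ hx, by rintro _ ⟨y, hy, rfl⟩; exact hmin hy⟩

theorem stageMin_mono {t : ℕ} {V V' : M.Info t → (Fin (M.m (t + 1)) → ℝ) → ℝ}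
    {R : Fin (M.m t) → ℝ} {w : M.Obs t} (hne : (M.X t R w).Nonempty)
    (hbd : BddBelow (M.obj t V w '' M.X t R w))
    (h : ∀ x ∈ M.X t R w, M.obj t V w x ≤ M.obj t V' w x) :
    M.stageMin t V R w ≤ M.stageMin t V' R w := by
  refine le_csInf (hne.image _) ?_
  rintro _ ⟨x, hx, rfl⟩
  exact (csInf_le hbd (Set.mem_image_of_mem _ hx)).trans (h x hx)

theorem bddBelow_obj {t : ℕ} {V : M.Info t → (Fin (M.m (t + 1)) → ℝ) → ℝ} {w : M.Obs t}
    (hV : IsMaxAffine (V (M.info t w))) {R : Fin (M.m t) → ℝ}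
    (hb : Bornology.IsBounded (M.X t R w)) : BddBelow (M.obj t V w '' M.X t R w) :=
  ((Metric.isCompact_of_isClosed_isBounded (isClosed_polyhedron _ _ R) hb).image
    (hV.linear_add_comp (M.c t w) (M.B t w)).continuous).bddBelow

/-- Verification: dynamic programming along a feasible policy bounds its cost from below by the
optimal value, and a policy that attains the minimum of the `V*`-objective at every visited state
attains the bound. -/
theorem isOptimalPolicy_of_isMinOn (hM : M.IsMarkov) (hpos : ∀ ω, 0 < M.prob ω)
    (hbd : ∀ ω, ∀ t ≤ T, ∀ R, M.Reach ω t R →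
      BddBelow (M.obj t (M.Vstar t) (M.obs t ω) '' M.X t R (M.obs t ω)))
    {x : M.Policy} (hx : M.IsFeasiblePolicy x)
    (hmin : ∀ ω, ∀ t ≤ T, IsMinOn (M.obj t (M.Vstar t) (M.obs t ω))
      (M.X t (M.state x ω t) (M.obs t ω)) (x t ω)) : M.IsOptimalPolicy x := by
  -- `J y t`: expected optimal cost of the stages from `t` on, at the states visited by `y`;
  -- `D y t`: the same if `y` also decides at stage `t`; `C y t`: expected cost of stage `t` alone.
  let J : M.Policy → ℕ → ℝ := fun y t =>
    ∑ ω, M.prob ω * M.stageMin t (M.Vstar t) (M.state y ω t) (M.obs t ω)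
  let D : M.Policy → ℕ → ℝ := fun y t =>
    ∑ ω, M.prob ω * M.obj t (M.Vstar t) (M.obs t ω) (y t ω)
  let C : M.Policy → ℕ → ℝ := fun y t => ∑ ω, M.prob ω * (M.c t (M.obs t ω) ⬝ᵥ y t ω)
  have hcost : ∀ y, M.cost y = ∑ t ∈ Finset.range (T + 1), C y t := by
    intro y
    simp only [cost, C, Finset.mul_sum]
    exact Finset.sum_comm
  have hstep : ∀ y, M.IsFeasiblePolicy y → ∀ t < T, D y t = C y t + J y (t + 1) := by
    intro y hy t ht
    have h1 := hM.sum_prob_mul_sum_trans hpos ht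
      (fun ω w => M.stageMin (t + 1) (M.Vstar (t + 1)) (M.state y ω (t + 1)) w)
      (fun ω ω' h => by
        have h2 : M.state y ω (t + 1) = M.state y ω' (t + 1) := by
          simp only [state, resIn, hy.1 t ht.le ω ω' h, h t le_rfl]
        simp only [h2])
    simp only [D, C, J]
    rw [← h1, ← Finset.sum_add_distrib]
    refine Finset.sum_congr rfl fun ω _ => ?_
    rw [obj, Vstar_eq ht, mul_add]
    rfl
  have hlast : ∀ y, D y T = C y T := fun y =>
    Finset.sum_congr rfl fun ω _ => by rw [obj, Vstar_self, add_zero]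
  have hJD : ∀ y, M.IsFeasiblePolicy y → ∀ t ≤ T, J y t ≤ D y t := fun y hy t ht =>
    Finset.sum_le_sum fun ω _ => mul_le_mul_of_nonneg_left
      (csInf_le (hbd ω t ht _ (hy.reach ω (ht.trans T.le_succ)))
        (Set.mem_image_of_mem _ (hy.2 ω t ht))) (M.prob_nonneg ω)
  have hJDx : ∀ t ≤ T, J x t = D x t := fun t ht =>
    Finset.sum_congr rfl fun ω _ => by rw [stageMin_eq (hx.2 ω t ht) (hmin ω t ht)]
  have hlower : ∀ y, M.IsFeasiblePolicy y → ∀ t ≤ T,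
      J y 0 ≤ ∑ s ∈ Finset.range t, C y s + J y t := by
    intro y hy t
    induction t with
    | zero => simp
    | succ t ih =>
      intro ht
      have h1 := ih (Nat.le_of_succ_le ht)
      have h2 := hJD y hy t (Nat.le_of_succ_le ht)
      rw [hstep y hy t ht] at h2
      rw [Finset.sum_range_succ]
      linarith
  have hattain : ∀ t ≤ T, J x 0 = ∑ s ∈ Finset.range t, C x s + J x t := by
    intro t
    induction t with
    | zero => simp
    | succ t ih =>
      intro ht
      have h1 := ih (Nat.le_of_succ_le ht)
      have h2 := hJDx t (Nat.le_of_succ_le ht)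
      rw [hstep x hx t ht] at h2
      rw [Finset.sum_range_succ]
      linarith
  refine ⟨hx, fun y hy => ?_⟩
  have h1 := hattain T le_rfl
  have h2 := hlower y hy T le_rfl
  have h3 := hJD y hy T le_rfl
  have h4 := hJDx T le_rfl
  have h5 : J x 0 = J y 0 := rfl
  rw [hlast] at h3 h4
  rw [hcost, hcost, Finset.sum_range_succ, Finset.sum_range_succ]
  linarith

/-! ### Cuts of a run -/

section Run

variable {Q : (t : ℕ) → Matrix (Fin (M.m (t + 1))) (Fin (M.m (t + 1))) ℝ} {ρ : ℕ → ℝ}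
  {r : M.Trace}

theorem IsRun.isFeasiblePolicy (hr : IsRun Q ρ r) (k : ℕ) : M.IsFeasiblePolicy (r.x k) :=
  ⟨hr.implementable k, fun ω t ht => hr.forward_mem k t ht ω⟩

theorem IsRun.cut_eq (hr : IsRun Q ρ r) (k : ℕ) {t : ℕ} (ht : t < T) (j : M.Info t)
    (R : Fin (M.m (t + 1)) → ℝ) :
    r.cut k t j R = ∑ w, M.trans t j w *
      (M.stageMin (t + 1) (r.Vbar k (t + 1)) (r.Rx k t) w +
        r.subgrad k (t + 1) w ⬝ᵥ (R - r.Rx k t)) := by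
  rw [Trace.cut, hr.backward_alpha k t ht, hr.backward_beta k t ht, sum_dotProduct,
    ← Finset.sum_add_distrib]
  exact Finset.sum_congr rfl fun w _ => by rw [smul_dotProduct, smul_eq_mul, mul_add]

theorem IsRun.cut_le (hr : IsRun Q ρ r) (k : ℕ) {t : ℕ} (ht : t < T) (j : M.Info t)
    {R : Fin (M.m (t + 1)) → ℝ} (hR : ∀ w, M.trans t j w ≠ 0 → (M.X (t + 1) R w).Nonempty) :
    r.cut k t j R ≤ ∑ w, M.trans t j w * M.stageMin (t + 1) (r.Vbar k (t + 1)) R w := by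
  rw [hr.cut_eq k ht]
  refine Finset.sum_le_sum fun w _ => ?_
  by_cases h0 : M.trans t j w = 0
  · simp [h0]
  · exact mul_le_mul_of_nonneg_left ((hr.backward_subgrad k t ht w).2 R (hR w h0))
      (trans_nonneg t j w)

theorem IsRun.Vbar_le_iff (hr : IsRun Q ρ r) (k : ℕ) {t : ℕ} (ht : t < T) (j : M.Info t)
    (R : Fin (M.m (t + 1)) → ℝ) (a : ℝ) :
    r.Vbar k t j R ≤ a ↔ ∀ i ≤ k, r.cut i t j R ≤ a := by
  induction k with
  | zero => simp [hr.Vbar_zero t ht]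
  | succ k ih =>
    rw [hr.Vbar_succ k t ht, max_le_iff, ih]
    constructor
    · rintro ⟨h1, h2⟩ i hi
      rcases Nat.le_succ_iff.1 hi with h | rfl
      exacts [h1 i h, h2]
    · exact fun h => ⟨fun i hi => h i (hi.trans k.le_succ), h _ le_rfl⟩

theorem IsRun.cut_le_Vbar (hr : IsRun Q ρ r) (k : ℕ) {t : ℕ} (ht : t < T) (j : M.Info t)
    (R : Fin (M.m (t + 1)) → ℝ) : r.cut k t j R ≤ r.Vbar k t j R :=
  (hr.Vbar_le_iff k ht j R _).1 le_rfl k le_rfl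

theorem IsRun.isMaxAffine_Vbar (hr : IsRun Q ρ r)
    (hT : ∀ k j R, r.Vbar k T j R = M.Vstar T j R) (k : ℕ) {t : ℕ} (ht : t ≤ T) (j : M.Info t) :
    IsMaxAffine (r.Vbar k t j) := by
  rcases ht.eq_or_lt with rfl | ht
  · have h0 : r.Vbar k t j = fun R => 0 + (0 : Fin (M.m (t + 1)) → ℝ) ⬝ᵥ R := by
      funext R
      rw [hT, Vstar_self, zero_dotProduct, add_zero]
    exact h0 ▸ IsMaxAffine.affine _ _
  · have hcut : ∀ i, IsMaxAffine (r.cut i t j) := fun i => by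
      have h0 : r.cut i t j = fun R =>
          (r.alpha i t j - r.beta i t j ⬝ᵥ r.Rx i t) + r.beta i t j ⬝ᵥ R := by
        funext R
        rw [Trace.cut, dotProduct_sub]; ring
      exact h0 ▸ IsMaxAffine.affine _ _
    induction k with
    | zero => exact (funext (hr.Vbar_zero t ht j) : r.Vbar 0 t j = _) ▸ hcut 0
    | succ k ih =>
      exact (funext (hr.Vbar_succ k t ht j) : r.Vbar (k + 1) t j = _) ▸ ih.max (hcut (k + 1))

theorem IsRun.monotone_Vbar (hr : IsRun Q ρ r)
    (hT : ∀ k j R, r.Vbar k T j R = M.Vstar T j R) {t : ℕ} (ht : t ≤ T) (j : M.Info t) :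
    Monotone fun k => r.Vbar k t j := by
  refine monotone_nat_of_le_succ fun k R => ?_
  rcases ht.eq_or_lt with rfl | ht
  · simp only [hT]; exact le_rfl
  · exact (hr.Vbar_succ k t ht j R).symm ▸ le_max_left _ _

/-- The approximations never exceed the optimal value functions on the reachable states. -/
theorem IsRun.Vbar_le_Vstar (hr : IsRun Q ρ r)
    (hT : ∀ k j R, r.Vbar k T j R = M.Vstar T j R) (hM : M.IsMarkov)
    (hrec : M.RelativelyCompleteRecourse)
    (hbdd : ∀ t ≤ T, ∀ (ω : M.Scen) (R : Fin (M.m t) → ℝ),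
      Bornology.IsBounded (M.X t R (M.obs t ω))) {t : ℕ} (ht : t ≤ T) :
    ∀ (k : ℕ) (ω : M.Scen) (R : Fin (M.m (t + 1)) → ℝ), M.Reach ω (t + 1) R →
      r.Vbar k t (M.info t (M.obs t ω)) R ≤ M.Vstar t (M.info t (M.obs t ω)) R := by
  induction ht using Nat.decreasingInduction with
  | self => exact fun k ω R _ => (hT k _ R).le
  | of_succ t ht ih =>
    intro k ω R hR
    refine (hr.Vbar_le_iff k ht _ R _).2 fun i _ => ?_
    -- every observation of positive transition probability extends the history within a scenario
    have hsucc : ∀ w, M.trans t (M.info t (M.obs t ω)) w ≠ 0 →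
        ∃ ω', M.Reach ω' (t + 1) R ∧ M.obs (t + 1) ω' = w := fun w hw => by
      obtain ⟨ω', h1, h2⟩ := hM.exists_scen ht hw
      exact ⟨ω', hR.congr fun s hs => (h1 s (Nat.lt_succ_iff.1 hs)).symm, h2⟩
    refine (hr.cut_le i ht _ fun w hw => ?_).trans ?_
    · obtain ⟨ω', h1, rfl⟩ := hsucc w hw
      exact h1.nonempty_X hrec ht
    rw [Vstar_eq ht]
    refine Finset.sum_le_sum fun w _ => ?_
    by_cases h0 : M.trans t (M.info t (M.obs t ω)) w = 0
    · simp [h0]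
    obtain ⟨ω', h1, rfl⟩ := hsucc w h0
    refine mul_le_mul_of_nonneg_left (stageMin_mono (h1.nonempty_X hrec ht)
      (bddBelow_obj (hr.isMaxAffine_Vbar hT i ht _) (hbdd (t + 1) ht ω' R)) fun x hx => ?_)
      (trans_nonneg _ _ _)
    exact add_le_add le_rfl (ih i ω' _ ⟨R, x, h1, hx, rfl⟩)

/-- A cut is determined by the value functions it supports and by its slopes, whatever the state
at which it is computed, because a convex function has only one tangent of a given slope. -/
theorem IsRun.cut_eq_cut {r' : M.Trace} (hr : IsRun Q ρ r) (hr' : IsRun Q ρ r') {k k' t : ℕ}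
    (ht : t < T)
    (hV : ∀ w, r.Vbar k (t + 1) (M.info (t + 1) w) = r'.Vbar k' (t + 1) (M.info (t + 1) w))
    (hg : ∀ w, r.subgrad k (t + 1) w = r'.subgrad k' (t + 1) w) (j : M.Info t) :
    r.cut k t j = r'.cut k' t j := by
  funext R
  rw [hr.cut_eq k ht, hr'.cut_eq k' ht]
  refine Finset.sum_congr rfl fun w _ => ?_
  obtain ⟨h1, h2⟩ := hr.backward_subgrad k t ht w
  obtain ⟨h3, h4⟩ := hr'.backward_subgrad k' t ht w
  have h5 := h2 _ h3
  have h6 := h4 _ h1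
  simp only [stageMin_congr (hV w), hg w, dotProduct_sub] at h5 h6 ⊢
  congr 1
  linarith

end Run

/-! ### Finiteness of the set of approximations -/

section Family

variable {Q : (t : ℕ) → Matrix (Fin (M.m (t + 1))) (Fin (M.m (t + 1))) ℝ} {ρ : ℕ → ℝ}
  {Ξ : Type*} {r : Ξ → M.Trace}

/-- Over all executions and iterations, only finitely many subgradients are selected. -/
theorem finite_range_subgrad (hr : ∀ ξ, IsRun Q ρ (r ξ))
    (hdual : ∀ ξ, UsesDualBasicSolutions (r ξ)) {t : ℕ} (ht : t + 1 ≤ T) :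
    ∀ w, (Set.range fun a : Ξ × ℕ => (r a.1).subgrad a.2 (t + 1) w).Finite := by
  suffices h : ∀ s t, t + 1 + s = T →
      ∀ w, (Set.range fun a : Ξ × ℕ => (r a.1).subgrad a.2 (t + 1) w).Finite from
    h (T - (t + 1)) t (by omega)
  clear ht t
  intro s
  induction s with
  | zero =>
    intro t ht w
    refine ((finite_dualBasic (M.A (t + 1) w) (M.B (t + 1) w) (M.c (t + 1) w)
      (Set.finite_singleton 0)).image Neg.neg).subset ?_
    rintro _ ⟨⟨ξ, k⟩, rfl⟩
    obtain ⟨y, z, h1, h2, h3⟩ := (hdual ξ k t (by omega) w).2 (by omega)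
    exact ⟨y, ⟨Unit, _, _, z, fun _ => rfl, h1.1, h2⟩, h3.symm⟩
  | succ s ih =>
    intro t ht w
    have hβ : (Set.range fun a : Ξ × ℕ =>
        (r a.1).beta a.2 (t + 1) (M.info (t + 1) w)).Finite := by
      refine (Set.Finite.range_pi (ih (t + 1) (by omega))).range_of_factor fun a a' h => ?_
      rw [(hr a.1).backward_beta a.2 _ (by omega), (hr a'.1).backward_beta a'.2 _ (by omega)]
      exact Finset.sum_congr rfl fun w' _ => congrArg _ (congrFun h w')
    refine ((finite_dualBasic (M.A (t + 1) w) (M.B (t + 1) w) (M.c (t + 1) w)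
      hβ).image Neg.neg).subset ?_
    rintro _ ⟨⟨ξ, k⟩, rfl⟩
    obtain ⟨y, z, h1, h2, h3⟩ := (hdual ξ k t (by omega) w).1 (by omega)
    exact ⟨y, ⟨Fin (k + 1), _, _, z, fun i => ⟨(ξ, i), rfl⟩, h1.1, h2⟩, h3.symm⟩

/-- Over all executions and iterations, only finitely many approximate value functions arise. -/
theorem finite_range_Vbar (hr : ∀ ξ, IsRun Q ρ (r ξ))
    (hT : ∀ ξ k j R, (r ξ).Vbar k T j R = M.Vstar T j R)
    (hdual : ∀ ξ, UsesDualBasicSolutions (r ξ)) {t : ℕ} (ht : t ≤ T) :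
    ∀ j, (Set.range fun a : Ξ × ℕ => (r a.1).Vbar a.2 t j).Finite := by
  induction ht using Nat.decreasingInduction with
  | self =>
    intro j
    refine (Set.finite_singleton (M.Vstar T j)).subset ?_
    rintro _ ⟨a, rfl⟩
    exact funext (hT a.1 a.2 j)
  | of_succ t ht ih =>
    intro j
    have hcut : (Set.range fun a : Ξ × ℕ => (r a.1).cut a.2 t j).Finite := by
      have h1 := Set.Finite.range_pi fun w => ih (M.info (t + 1) w)
      have h2 := Set.Finite.range_pi (finite_range_subgrad hr hdual ht)
      have h3 : (Set.range fun a : Ξ × ℕ =>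
          ((fun w => (r a.1).Vbar a.2 (t + 1) (M.info (t + 1) w)),
            fun w => (r a.1).subgrad a.2 (t + 1) w)).Finite :=
        (h1.prod h2).subset (by rintro _ ⟨a, rfl⟩; exact ⟨⟨a, rfl⟩, a, rfl⟩)
      refine h3.range_of_factor fun a a' h => ?_
      exact (hr a.1).cut_eq_cut (hr a'.1) ht (congrFun (congrArg Prod.fst h))
        (congrFun (congrArg Prod.snd h)) j
    have hsets : (Set.range fun a : Ξ × ℕ =>
        (fun i => (r a.1).cut i t j) '' Set.Iic a.2).Finite := by
      refine hcut.finite_subsets.subset ?_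
      rintro _ ⟨a, rfl⟩ _ ⟨i, -, rfl⟩
      exact ⟨(a.1, i), rfl⟩
    refine hsets.range_of_factor fun a a' h => ?_
    have hle : ∀ a a' : Ξ × ℕ, (fun i => (r a.1).cut i t j) '' Set.Iic a.2 =
        (fun i => (r a'.1).cut i t j) '' Set.Iic a'.2 →
        (r a.1).Vbar a.2 t j ≤ (r a'.1).Vbar a'.2 t j := by
      intro a a' h R
      refine ((hr a.1).Vbar_le_iff _ ht j R _).2 fun i hi => ?_
      obtain ⟨i', hi', h'⟩ := h ▸ Set.mem_image_of_mem (fun i => (r a.1).cut i t j)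
        (show i ∈ Set.Iic a.2 from hi)
      rw [← congrFun h' R]
      exact ((hr a'.1).Vbar_le_iff _ ht j R _).1 le_rfl i' hi'
    exact le_antisymm (hle a a' h) (hle a' a h.symm)

/-- The approximations of iteration `k` are known at the start of iteration `k + 1`. Their heights
need no separate measurability argument: each cut is a function of finitely valued measurable
quantities, the value functions of the next stage and the selected subgradients. -/
theorem isFiniteValued_Vbar {mΞ : MeasurableSpace Ξ} {μ : Measure Ξ} {𝒢 : Filtration ℕ mΞ}
    (hr : ∀ ξ, IsRun Q ρ (r ξ)) (hs : IsSampling μ 𝒢 r)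
    (hT : ∀ ξ k j R, (r ξ).Vbar k T j R = M.Vstar T j R)
    (hdual : ∀ ξ, UsesDualBasicSolutions (r ξ)) {t : ℕ} (ht : t ≤ T) :
    ∀ k j, IsFiniteValued (𝒢 (k + 1)) fun ξ => (r ξ).Vbar k t j := by
  induction ht using Nat.decreasingInduction with
  | self =>
    intro k j
    have h0 : (fun ξ => (r ξ).Vbar k T j) = fun _ => M.Vstar T j :=
      funext fun ξ => funext (hT ξ k j)
    rw [h0]
    exact ⟨(Set.finite_singleton (M.Vstar T j)).subset (by rintro _ ⟨_, rfl⟩; rfl),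
      fun a => MeasurableSet.const _⟩
  | of_succ t ht ih =>
    intro k j
    have hsub : ∀ k w, IsFiniteValued (𝒢 (k + 1)) fun ξ => (r ξ).subgrad k (t + 1) w :=
      fun k w => ⟨(finite_range_subgrad hr hdual ht w).subset
        (by rintro _ ⟨ξ, rfl⟩; exact ⟨(ξ, k), rfl⟩),
        fun a => hs.backward_meas k t ht w (measurableSet_singleton a)⟩
    have hcut : ∀ k, IsFiniteValued (𝒢 (k + 1)) fun ξ => (r ξ).cut k t j := fun k =>
      ((IsFiniteValued.pi fun w => ih k (M.info (t + 1) w)).prodMk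
        (IsFiniteValued.pi (hsub k))).factor fun ξ ξ' h =>
          (hr ξ).cut_eq_cut (hr ξ') ht (congrFun (congrArg Prod.fst h))
            (congrFun (congrArg Prod.snd h)) j
    induction k with
    | zero =>
      refine (hcut 0).factor fun ξ ξ' h => funext fun R => ?_
      rw [(hr ξ).Vbar_zero t ht, (hr ξ').Vbar_zero t ht]
      exact congrFun h R
    | succ k ihk =>
      refine ((ihk.mono (𝒢.mono (k + 1).le_succ)).prodMk (hcut (k + 1))).factor
        fun ξ ξ' h => funext fun R => ?_
      rw [(hr ξ).Vbar_succ k t ht, (hr ξ').Vbar_succ k t ht]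
      exact congrArg₂ max (congrFun (congrArg Prod.fst h) R) (congrFun (congrArg Prod.snd h) R)

end Family

end StochLP

namespace StochLP

variable {T : ℕ} {M : StochLP T}
  {Q : (t : ℕ) → Matrix (Fin (M.m (t + 1))) (Fin (M.m (t + 1))) ℝ} {ρ : ℕ → ℝ}

/-! ### Stabilization and exactness of the regularized forward pass -/

/-- In each execution the approximate value functions are eventually constant. -/
theorem eventually_Vbar_eq {Ξ : Type*} {r : Ξ → M.Trace} (hr : ∀ ξ, IsRun Q ρ (r ξ))
    (hT : ∀ ξ k j R, (r ξ).Vbar k T j R = M.Vstar T j R)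
    (hdual : ∀ ξ, UsesDualBasicSolutions (r ξ)) (ξ : Ξ) :
    ∃ K, ∀ k ≥ K, ∀ t ≤ T, ∀ w,
      (r ξ).Vbar k t (M.info t w) = (r ξ).Vbar K t (M.info t w) := by
  have h1 : ∀ t ≤ T, ∀ w : M.Obs t, ∀ᶠ K in atTop, ∀ k ≥ K,
      (r ξ).Vbar k t (M.info t w) = (r ξ).Vbar K t (M.info t w) := by
    intro t ht w
    obtain ⟨K, hK⟩ := eventually_eq_of_monotone_of_finite_range
      ((hr ξ).monotone_Vbar (hT ξ) ht (M.info t w))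
      ((finite_range_Vbar hr hT hdual ht (M.info t w)).subset
        (by rintro _ ⟨k, rfl⟩; exact ⟨(ξ, k), rfl⟩))
    filter_upwards [eventually_ge_atTop K] with K' hK' k hk
    exact (hK k (hK'.trans hk)).trans (hK K' hK').symm
  have h2 : ∀ᶠ K in atTop, ∀ t ∈ Set.Iic T, ∀ w : M.Obs t, ∀ k ≥ K,
      (r ξ).Vbar k t (M.info t w) = (r ξ).Vbar K t (M.info t w) :=
    (Filter.eventually_all_finite (Set.finite_Iic T)).2 fun t ht => eventually_all.2 (h1 t ht)
  obtain ⟨K, hK⟩ := h2.exists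
  exact ⟨K, fun k hk t ht w => hK t ht w k hk⟩

/-- Once the value functions have stabilized and the penalty coefficient is small, the regularized
forward decisions minimize the unregularized objectives, along every scenario. -/
theorem IsRun.eventually_isMinOn {r : M.Trace} (hr : IsRun Q ρ r)
    (hT : ∀ k j R, r.Vbar k T j R = M.Vstar T j R)
    (hρ : ∀ k, 0 ≤ ρ k) (hρlim : Tendsto ρ atTop (𝓝 0))
    (hbdd : ∀ t ≤ T, ∀ (ω : M.Scen) (R : Fin (M.m t) → ℝ),
      Bornology.IsBounded (M.X t R (M.obs t ω)))
    (hstab : ∃ K, ∀ k ≥ K, ∀ t ≤ T, ∀ w, r.Vbar k t (M.info t w) = r.Vbar K t (M.info t w)) :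
    ∀ᶠ k in atTop, ∀ t ∈ Set.Iic T, ∀ ω,
      IsMinOn (M.obj t (r.Vbar k t) (M.obs t ω))
        (M.X t (M.state (r.x (k + 1)) ω t) (M.obs t ω)) (r.x (k + 1) t ω) := by
  obtain ⟨K, hK⟩ := hstab
  refine (Filter.eventually_all_finite (Set.finite_Iic T)).2 fun t ht => eventually_all.2 fun ω => ?_
  have ht : t ≤ T := ht
  rcases ht.eq_or_lt with rfl | htlt
  · refine Eventually.of_forall fun k => ?_
    have h1 := hr.forward_min (k + 1) t ht ω
    simpa only [Trace.forwardObj, lt_irrefl, if_false, add_zero] using h1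
  obtain ⟨N, hN⟩ := exists_norm_le_of_reach hbdd (Nat.succ_le_succ ht)
  obtain ⟨ρ₀, hρ₀, hexact⟩ := ((hr.isMaxAffine_Vbar hT K ht (M.info t (M.obs t ω))).linear_add_comp
    (M.c t (M.obs t ω)) (M.B t (M.obs t ω))).exists_exact_regularization (M.A t (M.obs t ω))
    (M.B t (M.obs t ω)) (Q t) (N + N)
  have hsmall : ∀ᶠ k in atTop, ρ (k + 1) < ρ₀ :=
    ((tendsto_add_atTop_iff_nat 1).2 hρlim).eventually (gt_mem_nhds hρ₀)
  filter_upwards [hsmall, eventually_ge_atTop K] with k hk hKk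
  have hobj : M.obj t (r.Vbar k t) (M.obs t ω) = M.obj t (r.Vbar K t) (M.obs t ω) :=
    funext fun x => by rw [obj, obj, hK k hKk t ht]
  obtain ⟨h1, h2⟩ := hr.forward_mem (k + 1) t ht ω
  have h3 := hr.forward_min (k + 1) t ht ω
  simp only [Trace.forwardObj, if_pos htlt, hobj] at h3
  rw [hobj]
  refine hexact (ρ (k + 1)) (hρ _) hk _ _ (r.Rx k t) _ h1 h2 ?_ h3
  exact (norm_sub_le _ _).trans (add_le_add
    (hN ω _ ((hr.isFeasiblePolicy (k + 1)).reach ω (Nat.succ_le_succ ht)))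
    (hN (r.sample k) _ ((hr.isFeasiblePolicy k).reach (r.sample k) (Nat.succ_le_succ ht))))

/-! ### Gaps of the approximation at the states of the forward policy -/

/-- At the post-decision state that the forward policy of iteration `k + 1` reaches at stage `t`
along `ω`, the approximation `V̄_t^k` lies strictly below the expected value of the next stage
problem, so that sampling `ω` in iteration `k + 1` yields a strictly improving cut. -/
def Trace.HasGap (r : M.Trace) (ω : M.Scen) (t k : ℕ) : Prop :=
  r.Vbar k t (M.info t (M.obs t ω)) (M.state (r.x (k + 1)) ω (t + 1)) <
    ∑ w, M.trans t (M.info t (M.obs t ω)) w *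
      M.stageMin (t + 1) (r.Vbar k (t + 1)) (M.state (r.x (k + 1)) ω (t + 1)) w

theorem IsRun.not_hasGap_of_Vbar_eq {r : M.Trace} (hr : IsRun Q ρ r) {t k : ℕ} (ht : t < T)
    (h0 : ∀ w, r.Vbar (k + 1) t (M.info t w) = r.Vbar k t (M.info t w))
    (h1 : ∀ w, r.Vbar (k + 1) (t + 1) (M.info (t + 1) w) = r.Vbar k (t + 1) (M.info (t + 1) w)) :
    ¬ r.HasGap (r.sample (k + 1)) t k := by
  refine not_lt.2 ?_
  have h2 := hr.cut_le_Vbar (k + 1) ht (M.info t (M.obs t (r.sample (k + 1)))) (r.Rx (k + 1) t)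
  rw [Trace.cut, sub_self, dotProduct_zero, add_zero, hr.backward_alpha _ t ht, h0] at h2
  refine le_trans (le_of_eq (Finset.sum_congr rfl fun w _ => ?_)) h2
  rw [stageMin_congr (h1 w)]
  rfl

theorem measurableSet_hasGap {Ξ : Type*} {mΞ : MeasurableSpace Ξ} {μ : Measure Ξ}
    {𝒢 : Filtration ℕ mΞ} {r : Ξ → M.Trace} (hM : M.IsMarkov) (hr : ∀ ξ, IsRun Q ρ (r ξ))
    (hs : IsSampling μ 𝒢 r) (hT : ∀ ξ k j R, (r ξ).Vbar k T j R = M.Vstar T j R)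
    (hdual : ∀ ξ, UsesDualBasicSolutions (r ξ))
    (hbdd : ∀ t ≤ T, ∀ (ω : M.Scen) (R : Fin (M.m t) → ℝ),
      Bornology.IsBounded (M.X t R (M.obs t ω)))
    (ω : M.Scen) {t : ℕ} (ht : t < T) (k : ℕ) :
    MeasurableSet[𝒢 (k + 1)] {ξ | (r ξ).HasGap ω t k} := by
  set j := M.info t (M.obs t ω)
  let F : Ξ → ((Fin (M.m (t + 1)) → ℝ) → ℝ) ×
      ((w : M.Obs (t + 1)) → (Fin (M.m (t + 1 + 1)) → ℝ) → ℝ) := fun ξ =>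
    ((r ξ).Vbar k t j, fun w => (r ξ).Vbar k (t + 1) (M.info (t + 1) w))
  have hF : IsFiniteValued (𝒢 (k + 1)) F :=
    (isFiniteValued_Vbar hr hs hT hdual ht.le k j).prodMk
      (IsFiniteValued.pi fun w => isFiniteValued_Vbar hr hs hT hdual ht k (M.info (t + 1) w))
  have hR : Measurable[𝒢 (k + 1)] fun ξ => M.state ((r ξ).x (k + 1)) ω (t + 1) :=
    (continuous_const.matrix_mulVec continuous_id :
      Continuous fun x => M.B t (M.obs t ω) *ᵥ x).measurable.comp
      (hs.forward_meas (k + 1) t ht.le ω)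
  let E : ((Fin (M.m (t + 1)) → ℝ) → ℝ) ×
      ((w : M.Obs (t + 1)) → (Fin (M.m (t + 1 + 1)) → ℝ) → ℝ) → Set (Fin (M.m (t + 1)) → ℝ) :=
    fun v => {R | v.1 R < ∑ w, M.trans t j w *
      sInf ((fun x => M.c (t + 1) w ⬝ᵥ x + v.2 w (M.B (t + 1) w *ᵥ x)) '' M.X (t + 1) R w)}
  have hE : ∀ v ∈ Set.range F, MeasurableSet (E v) := by
    rintro _ ⟨ξ, rfl⟩
    refine measurableSet_lt ((hr ξ).isMaxAffine_Vbar (hT ξ) k ht.le j).continuous.measurable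
      (Finset.measurable_sum _ fun w _ => ?_)
    by_cases h0 : M.trans t j w = 0
    · simp only [h0, zero_mul]; exact measurable_const
    · obtain ⟨ω', -, rfl⟩ := hM.exists_scen ht h0
      exact measurable_const.mul (measurable_sInf_polyhedron _ _
        (fun R => hbdd (t + 1) ht ω' R)
        (((hr ξ).isMaxAffine_Vbar (hT ξ) k ht _).linear_add_comp _ _).continuous)
  have : {ξ | (r ξ).HasGap ω t k} = ⋃ v ∈ Set.range F, F ⁻¹' {v} ∩
      (fun ξ => M.state ((r ξ).x (k + 1)) ω (t + 1)) ⁻¹' E v := by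
    ext ξ
    simp only [Set.mem_iUnion]
    constructor
    · exact fun h => ⟨F ξ, ⟨ξ, rfl⟩, rfl, h⟩
    · rintro ⟨v, -, h1, h2⟩
      obtain rfl : F ξ = v := h1
      exact h2
  rw [this]
  exact MeasurableSet.biUnion hF.finite_range.countable fun v hv =>
    (hF.level v).inter (hR (hE v hv))

/-- Almost surely, from some iteration on there is no gap along any scenario, sampled or not: a gap
along `ω` is followed by a change of the value functions whenever `ω` is sampled, which has a fixed
positive conditional probability, while only finitely many changes occur. -/
theorem ae_eventually_not_hasGap {Ξ : Type*} {mΞ : MeasurableSpace Ξ} {μ : Measure Ξ}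
    [IsProbabilityMeasure μ] {𝒢 : Filtration ℕ mΞ} {r : Ξ → M.Trace} (hM : M.IsMarkov)
    (hr : ∀ ξ, IsRun Q ρ (r ξ)) (hs : IsSampling μ 𝒢 r)
    (hT : ∀ ξ k j R, (r ξ).Vbar k T j R = M.Vstar T j R)
    (hdual : ∀ ξ, UsesDualBasicSolutions (r ξ)) (hpos : ∀ ω, 0 < M.prob ω)
    (hbdd : ∀ t ≤ T, ∀ (ω : M.Scen) (R : Fin (M.m t) → ℝ),
      Bornology.IsBounded (M.X t R (M.obs t ω))) :
    ∀ᵐ ξ ∂μ, ∀ᶠ k in atTop, ∀ t ∈ Set.Iio T, ∀ ω, ¬ (r ξ).HasGap ω t k := by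
  have h1 : ∀ t ∈ Set.Iio T, ∀ ω, ∀ᵐ ξ ∂μ, ∀ᶠ k in atTop, ¬ (r ξ).HasGap ω t k := by
    intro t ht ω
    let A : ℕ → Set Ξ := fun n => Nat.casesOn n ∅ fun k => {ξ | (r ξ).HasGap ω t k}
    have hA : ∀ n, MeasurableSet[𝒢 n] (A n) := by
      rintro (_ | k)
      · exact @MeasurableSet.empty _ (𝒢 0)
      · exact measurableSet_hasGap hM hr hs hT hdual hbdd ω ht k
    have h2 := ae_eventually_notMem_of_inter (μ := μ) (hpos ω) hA
      (fun k => hs.sample_meas k ω) (fun k E hE => hs.sample_law k ω E hE) (by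
        refine Eventually.of_forall fun ξ => ?_
        obtain ⟨K, hK⟩ := eventually_Vbar_eq hr hT hdual ξ
        filter_upwards [eventually_ge_atTop (K + 1)] with n hn
        obtain ⟨k, rfl⟩ : ∃ k, n = k + 1 := ⟨n - 1, by omega⟩
        have hk : K ≤ k := Nat.le_of_succ_le_succ hn
        rintro ⟨h3, rfl⟩
        have hV : ∀ s ≤ T, ∀ w, (r ξ).Vbar (k + 1) s (M.info s w) = (r ξ).Vbar k s (M.info s w) :=
          fun s hs w => (hK _ (hk.trans k.le_succ) s hs w).trans (hK k hk s hs w).symm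
        exact (hr ξ).not_hasGap_of_Vbar_eq ht (hV t (le_of_lt ht)) (hV (t + 1) ht) h3)
    filter_upwards [h2] with ξ h3
    exact (tendsto_add_atTop_nat 1).eventually h3
  have h2 : ∀ᵐ ξ ∂μ, ∀ t ∈ Set.Iio T, ∀ ω, ∀ᶠ k in atTop, ¬ (r ξ).HasGap ω t k :=
    (ae_ball_iff (Set.finite_Iio T).countable).2 fun t ht => ae_all_iff.2 (h1 t ht)
  filter_upwards [h2] with ξ h3
  exact (Filter.eventually_all_finite (Set.finite_Iio T)).2 fun t ht => eventually_all.2 (h3 t ht)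

/-! ### Optimality in the absence of gaps -/

/-- If the policy of iteration `k` minimizes the approximate objectives and the approximation has
no gap along it, then by backward induction the approximate and the optimal stage values agree at
all visited states, and the decisions also minimize the `V*`-objectives. -/
theorem IsRun.stageMin_eq_and_isMinOn {r : M.Trace} (hr : IsRun Q ρ r)
    (hT : ∀ k j R, r.Vbar k T j R = M.Vstar T j R) (hM : M.IsMarkov)
    (hrec : M.RelativelyCompleteRecourse)
    (hbdd : ∀ t ≤ T, ∀ (ω : M.Scen) (R : Fin (M.m t) → ℝ),
      Bornology.IsBounded (M.X t R (M.obs t ω))) {k : ℕ}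
    (hmin : ∀ t ≤ T, ∀ ω, IsMinOn (M.obj t (r.Vbar k t) (M.obs t ω))
      (M.X t (M.state (r.x k) ω t) (M.obs t ω)) (r.x k t ω))
    (hgap : ∀ t < T, ∀ ω, ∑ w, M.trans t (M.info t (M.obs t ω)) w *
        M.stageMin (t + 1) (r.Vbar k (t + 1)) (M.state (r.x k) ω (t + 1)) w ≤
      r.Vbar k t (M.info t (M.obs t ω)) (M.state (r.x k) ω (t + 1)))
    {t : ℕ} (ht : t ≤ T) :
    ∀ ω, M.stageMin t (r.Vbar k t) (M.state (r.x k) ω t) (M.obs t ω) =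
        M.stageMin t (M.Vstar t) (M.state (r.x k) ω t) (M.obs t ω) ∧
      IsMinOn (M.obj t (M.Vstar t) (M.obs t ω))
        (M.X t (M.state (r.x k) ω t) (M.obs t ω)) (r.x k t ω) := by
  have hx := hr.isFeasiblePolicy k
  induction ht using Nat.decreasingInduction with
  | self =>
    intro ω
    have h0 : r.Vbar k T = M.Vstar T := funext fun j => funext (hT k j)
    have h1 := hmin T le_rfl ω
    rw [h0] at h1 ⊢
    exact ⟨rfl, h1⟩
  | of_succ t ht ih =>
    intro ω
    have hmem := hx.2 ω t ht.le
    have hle : ∀ y ∈ M.X t (M.state (r.x k) ω t) (M.obs t ω),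
        M.obj t (r.Vbar k t) (M.obs t ω) y ≤ M.obj t (M.Vstar t) (M.obs t ω) y := fun y hy =>
      add_le_add le_rfl (hr.Vbar_le_Vstar hT hM hrec hbdd ht.le k ω _
        ⟨_, y, hx.reach ω (ht.le.trans T.le_succ), hy, rfl⟩)
    have hge : M.obj t (M.Vstar t) (M.obs t ω) (r.x k t ω) ≤
        M.obj t (r.Vbar k t) (M.obs t ω) (r.x k t ω) := by
      refine add_le_add le_rfl (le_trans (le_of_eq ?_) (hgap t ht ω))
      rw [Vstar_eq ht]
      refine Finset.sum_congr rfl fun w _ => ?_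
      by_cases h0 : M.trans t (M.info t (M.obs t ω)) w = 0
      · simp [h0]
      obtain ⟨ω', h1, rfl⟩ := hM.exists_scen ht h0
      have h2 : M.state (r.x k) ω' (t + 1) = M.state (r.x k) ω (t + 1) := by
        simp only [state, resIn, hx.1 t ht.le ω' ω h1, h1 t le_rfl]
      rw [← h2, (ih ω').1, h2]
      rfl
    have hmin' : IsMinOn (M.obj t (M.Vstar t) (M.obs t ω))
        (M.X t (M.state (r.x k) ω t) (M.obs t ω)) (r.x k t ω) := fun y hy =>
      hge.trans ((hmin t ht.le ω hy).trans (hle y hy))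
    refine ⟨?_, hmin'⟩
    rw [stageMin_eq hmem (hmin t ht.le ω), stageMin_eq hmem hmin']
    exact le_antisymm (hle _ hmem) hge

end StochLP

theorem mainTheorem2 {T : ℕ} (M : StochLP T)
    (hmarkov : M.IsMarkov) (hrecourse : M.RelativelyCompleteRecourse)
    (Q : (t : ℕ) → Matrix (Fin (M.m (t + 1))) (Fin (M.m (t + 1))) ℝ)
    (hQ : ∀ t ≤ T, (Q t).PosSemidef) (ρ : ℕ → ℝ)
    {Ξ : Type*} {mΞ : MeasurableSpace Ξ} (μ : Measure Ξ) [IsProbabilityMeasure μ]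
    (𝒢 : Filtration ℕ mΞ) (r : Ξ → M.Trace)
    (hrun : ∀ ξ, StochLP.IsRun Q ρ (r ξ))
    (hsampling : StochLP.IsSampling μ 𝒢 r)
    (hterminal : ∀ ξ k j R, (r ξ).Vbar k T j R = M.Vstar T j R)
    (hdual : ∀ ξ, StochLP.UsesDualBasicSolutions (r ξ))
    (hpos : ∀ ω, 0 < M.prob ω)
    (hρ : ∀ k, 0 ≤ ρ k) (hρlim : Tendsto ρ atTop (𝓝 0))
    (hbdd : ∀ t ≤ T, ∀ (ω : M.Scen) (R : Fin (M.m t) → ℝ),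
      Bornology.IsBounded (M.X t R (M.obs t ω))) :
    ∀ᵐ ξ ∂μ, ∃ K : ℕ, ∀ k ≥ K,
      M.IsOptimalPolicy ((r ξ).x k) ∧
      ∀ ω, ∀ t ≤ T,
        IsMinOn (M.obj t ((r ξ).Vbar k t) (M.obs t ω))
          (M.X t (M.state ((r ξ).x k) ω t) (M.obs t ω)) ((r ξ).x k t ω) ∧
        M.stageMin t ((r ξ).Vbar k t) (M.state ((r ξ).x k) ω t) (M.obs t ω) =
          M.stageMin t (M.Vstar t) (M.state ((r ξ).x k) ω t) (M.obs t ω) := by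
  filter_upwards [StochLP.ae_eventually_not_hasGap hmarkov hrun hsampling hterminal hdual hpos
    hbdd] with ξ hgap
  have hr := hrun ξ
  have hstab := StochLP.eventually_Vbar_eq hrun hterminal hdual ξ
  obtain ⟨K₀, hK₀⟩ := hstab
  obtain ⟨K, hK⟩ := eventually_atTop.1 (((hr.eventually_isMinOn (hterminal ξ) hρ hρlim hbdd
    ⟨K₀, hK₀⟩).and hgap).and (eventually_ge_atTop K₀))
  refine ⟨K + 1, fun n hn => ?_⟩
  obtain ⟨k, rfl⟩ : ∃ k, n = k + 1 := ⟨n - 1, by omega⟩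
  obtain ⟨⟨hmin, hno⟩, hk⟩ := hK k (Nat.le_of_succ_le_succ hn)
  have hV : ∀ t ≤ T, ∀ w, (r ξ).Vbar (k + 1) t (M.info t w) = (r ξ).Vbar k t (M.info t w) :=
    fun t ht w => (hK₀ _ (hk.trans k.le_succ) t ht w).trans (hK₀ k hk t ht w).symm
  have hmin' : ∀ t ≤ T, ∀ ω, IsMinOn (M.obj t ((r ξ).Vbar (k + 1) t) (M.obs t ω))
      (M.X t (M.state ((r ξ).x (k + 1)) ω t) (M.obs t ω)) ((r ξ).x (k + 1) t ω) := by
    intro t ht ω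
    have h1 : M.obj t ((r ξ).Vbar (k + 1) t) (M.obs t ω) =
        M.obj t ((r ξ).Vbar k t) (M.obs t ω) :=
      funext fun x => by rw [StochLP.obj, StochLP.obj, hV t ht]
    rw [h1]
    exact hmin t ht ω
  have hgap' : ∀ t < T, ∀ ω, ∑ w, M.trans t (M.info t (M.obs t ω)) w *
      M.stageMin (t + 1) ((r ξ).Vbar (k + 1) (t + 1)) (M.state ((r ξ).x (k + 1)) ω (t + 1)) w ≤
      (r ξ).Vbar (k + 1) t (M.info t (M.obs t ω)) (M.state ((r ξ).x (k + 1)) ω (t + 1)) := by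
    intro t ht ω
    rw [hV t ht.le]
    refine le_trans (le_of_eq (Finset.sum_congr rfl fun w _ => ?_)) (not_lt.1 (hno t ht ω))
    rw [StochLP.stageMin_congr (hV (t + 1) ht w)]
  have hopt := fun t (ht : t ≤ T) => hr.stageMin_eq_and_isMinOn (hterminal ξ) hmarkov hrecourse
    hbdd hmin' hgap' ht
  refine ⟨StochLP.isOptimalPolicy_of_isMinOn hmarkov hpos (fun ω t ht R hR => ?_)
    (hr.isFeasiblePolicy (k + 1)) fun ω t ht => (hopt t ht ω).2,
    fun ω t ht => ⟨hmin' t ht ω, (hopt t ht ω).1⟩⟩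
  -- `V*` dominates the max-affine approximation, whose objective is bounded below
  obtain ⟨a, ha⟩ := StochLP.bddBelow_obj (hr.isMaxAffine_Vbar (hterminal ξ) 0 ht _)
    (hbdd t ht ω R)
  refine ⟨a, ?_⟩
  rintro _ ⟨x, hx, rfl⟩
  exact (ha (Set.mem_image_of_mem _ hx)).trans (add_le_add le_rfl
    (hr.Vbar_le_Vstar (hterminal ξ) hmarkov hrecourse hbdd ht 0 ω _ ⟨R, x, hR, hx, rfl⟩))
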